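/- Let $G$ be a (finite-dimensional) Lie group with Lie algebra $\mathfrak g$ (the bracket being that of left-invariant vector fields), and let $\langle\cdot,\cdot\rangle$ be a symmetric non-degenerate bilinear form on $\mathfrak g$ with $\langle[a,b],c\rangle+\langle b,[a,c]\rangle=0$ for all $a,b,c\in\mathfrak g$. Let $NG_\bullet$ be the nerve of $G$: $NG_p=G^p$, where $d_0$ drops the first entry, $d_p$ drops the last one, $d_j$ $(0<j<p)$ multiplies $g_j$ with $g_{j+1}$, and $s_j$ inserts $e$ after the first $j$ entries. Put $\delta=\sum_i(-1)^id_i^*$ on $\Omega^q(NG_\bullet)$ and $D=\delta+(-1)^pd$ on $\Omega^q(NG_p)$; let $\widehat\Omega^q(NG_p)$ be the normalized forms, those with $s_j^*\alpha=0$ for all $j$. Let $\theta^l,\theta^r\in\Omega^1(G;\mathfrak g)$ be the left and right Maurer-Cartan forms and $$\Omega_\bullet=\Omega-\Theta+0,\qquad \Omega=\langle d_2^*\theta^l,d_0^*\theta^r\rangle\in\Omega^2(NG_2),\qquad \Theta=\tfrac16\langle\theta^l,[\theta^l,\theta^l]\rangle\in\Omega^3(NG_1).$$ Let $W^{p,q}\mathfrak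 g=\wedge^{p-q}\mathfrak g^*\otimes S^q\mathfrak g^*$ (zero for $p<q$) be the bigraded Weil algebra, that is, the $q$-forms on $\mathfrak g[1]$ of degree $p$. Its elements are regarded as functions $c(a_1,\dots,a_{p-q}\,|\,b_1,\dots,b_q)$ that are multilinear, alternating in the $a$'s and symmetric in the $b$'s; a symmetric multilinear form is identified with the polynomial that is its restriction to the diagonal. Let $d^h=\mathcal L_{d_{CE}}$ be the Chevalley-Eilenberg differential with coefficients in $S^q\mathfrak g^*$, and $d^v$ the de Rham differential of $\mathfrak g[1]$. For $a\in\mathfrak g$ let $\widehat a=(a^L,0,\dots,0)$ on $G^{p}$ with $a^L$ the left-invariant vector field, and put $R_a=s_0^*\mathcal L_{\widehat a}$, $J_a=s_0^*\iota_{\widehat a}$. The Arias Abad-Crainic Van Est map $VE:\widehat\Omega^q(NG_p)\to W^{p,q}\mathfrak g$ is $$VE(\omega)(a_1,\dots,a_{p-q}\,|\,b_1,\dots,b_q)=(-1)^{q(q+1)/2}\,\frac1{q!}\sum\pm\,D_p\cdots D_1\,\omega ,$$ the sum being over all arrangements $D_1,\dots,D_p$ (with $D_1$ applied first) of the operators $R_{a_1},\dots,R_{a_{p-q}},J_{b_1},\dots,J_{b_q}$,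 with the sign of the permutation that takes this standard order to the order $D_1,\dots,D_p$, where inversions between two $J$'s are not counted; so $VE=0$ for $p<q$. On $\Omega_\bullet$ it is applied to each component. Then the following holds. 1. $\langle\cdot,\cdot\rangle\in S^2\mathfrak g^*=W^{2,2}\mathfrak g$, the components of $\Omega_\bullet$ are smooth normalized forms, and $$VE(\Omega_\bullet)=-\langle\cdot,\cdot\rangle ,$$ i.e. $VE(\Omega)=-\langle\cdot,\cdot\rangle$ and the components of $VE(\Omega_\bullet)$ in $W^{1,3}\mathfrak g$ and $W^{0,4}\mathfrak g$ vanish. 2. $(\mathfrak g[1],d_{CE},\langle\cdot,\cdot\rangle)$ is a symplectic $Q$-manifold of degree $2$: $d^v\langle\cdot,\cdot\rangle=0$, $d^h\langle\cdot,\cdot\rangle=0$, and $\langle\cdot,\cdot\rangle$ is non-degenerate. 3. If $G$ is connected, or more generally if $\langle\cdot,\cdot\rangle$ is $\mathrm{Ad}(G)$-invariant, then $(NG_\bullet,\Omega_\bullet)$ integrates $(\mathfrak g[1],d_{CE},\langle\cdot,\cdot\rangle)$. This means that $\Omega_\bullet$ is a $2$-shifted symplectic form on $NG_\bullet$, that the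 target is a degree $2$ symplectic $Q$-manifold as in 2, and that $VE(\Omega_\bullet)=-\langle\cdot,\cdot\rangle$. Here $2$-shifted symplectic means that $\Omega_\bullet$ is normalized, that $D\Omega_\bullet=0$ (i.e. $\delta\Omega=0$, $d\Omega-\delta\Theta=0$, $d\Theta=0$), and that for $l=0,1,2$ the pairing of $H_l$ and $H_{2-l}$ of the tangent complex $\mathcal T_l=\bigcap_{i<l}\ker T_ed_i\subset T_eG^l$, $\partial=(-1)^lT_ed_l$, given by $$\lambda(v,w)=\sum_{\sigma\in \mathrm{Shuff}_{l,2-l}}(-1)^\sigma\,\Omega_{(e,e)}\big(T(s_{\sigma(1)}\cdots s_{\sigma(l)})v,\;T(s_{\sigma(l-1)}\cdots s_{\sigma(0)})w\big),$$ is non-degenerate. -/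

import Mathlib

open scoped Manifold ContDiff Topology

noncomputable section

namespace VanEst

/-! ### Differential forms on finite-dimensional manifolds -/

/-- Alternating multilinear maps on a finite-dimensional space are continuous. -/
theorem continuous_alternating {E : Type*} [NormedAddCommGroup E] [NormedSpace ℝ E]
    [FiniteDimensional ℝ E] {q : ℕ} (f : E [⋀^Fin q]→ₗ[ℝ] ℝ) : Continuous f := by
  let b := Module.finBasis ℝ E
  have h : ∀ v : Fin q → E, f v =
      ∑ r : Fin q → Fin (Module.finrank ℝ E),
        (∏ i, b.coord (r i) (v i)) * f (fun i => b (r i)) := by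
    intro v
    have hv : v = fun i => ∑ j, b.coord j (v i) • b j := by
      funext i
      simp [b.sum_repr]
    conv_lhs => rw [hv]
    have h1 := f.toMultilinearMap.map_sum (fun (i : Fin q) j => b.coord j (v i) • b j)
    simp only [AlternatingMap.coe_multilinearMap] at h1
    rw [h1]
    refine Finset.sum_congr rfl fun r _ => ?_
    have h2 := f.toMultilinearMap.map_smul_univ (fun i => b.coord (r i) (v i)) (fun i => b (r i))
    simpa using h2
  have h' : (f : (Fin q → E) → ℝ) = fun v => ∑ r : Fin q → Fin (Module.finrank ℝ E),
        (∏ i, b.coord (r i) (v i)) * f (fun i => b (r i)) := funext h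
  rw [h']
  refine continuous_finsetSum _ fun r _ => Continuous.mul ?_ continuous_const
  refine continuous_finsetProd _ fun i _ => ?_
  exact (LinearMap.continuous_of_finiteDimensional (b.coord (r i))).comp (continuous_apply i)

/-- An alternating multilinear map on a finite-dimensional space as a continuous one. -/
def toContinuousAlternating {E : Type*} [NormedAddCommGroup E] [NormedSpace ℝ E]
    [FiniteDimensional ℝ E] {q : ℕ} (f : E [⋀^Fin q]→ₗ[ℝ] ℝ) : E [⋀^Fin q]→L[ℝ] ℝ :=
  { f with cont := continuous_alternating f }

/-- (Not necessarily smooth) differential `q`-forms on `M` with values in a vector space `V`. -/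
abbrev Form {E : Type*} [NormedAddCommGroup E] [NormedSpace ℝ E] {H : Type*} [TopologicalSpace H]
    (I : ModelWithCorners ℝ E H) (M : Type*) [TopologicalSpace M] [ChartedSpace H M]
    (V : Type*) [AddCommGroup V] [Module ℝ V] (q : ℕ) :=
  (x : M) → (TangentSpace I x) [⋀^Fin q]→ₗ[ℝ] V

section Forms

variable {E : Type*} [NormedAddCommGroup E] [NormedSpace ℝ E]
  {H : Type*} [TopologicalSpace H] {I : ModelWithCorners ℝ E H}
  {M : Type*} [TopologicalSpace M] [ChartedSpace H M]
  {E' : Type*} [NormedAddCommGroup E'] [NormedSpace ℝ E']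
  {H' : Type*} [TopologicalSpace H'] {J : ModelWithCorners ℝ E' H'}
  {N : Type*} [TopologicalSpace N] [ChartedSpace H' N]
  {V V₁ V₂ : Type*} [AddCommGroup V] [Module ℝ V] [AddCommGroup V₁] [Module ℝ V₁]
  [AddCommGroup V₂] [Module ℝ V₂]

/-- Pullback of a form along a (differentiable) map. -/
def pullback (I : ModelWithCorners ℝ E H) (J : ModelWithCorners ℝ E' H') {q : ℕ} (f : M → N)
    (η : Form J N V q) : Form I M V q :=
  fun x => (η (f x)).compLinearMap (mfderiv I J f x).toLinearMap

/-- Contraction of a form with a vector field in the first slot. -/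
def contract {q : ℕ} (X : (x : M) → TangentSpace I x) (η : Form I M V (q + 1)) : Form I M V q :=
  fun x => (η x).curryLeft (X x)

/-- The wedge product `b(α ∧ β)` of a `V₁`-valued `1`-form and a `V₂`-valued `q`-form along a
bilinear map `b`:
`b(α ∧ β)(v₀, …, v_q) = ∑ i, (-1)^i b(α(v_i), β(v₀, …, v̂_i, …, v_q))`. -/
def wedgeOne {q : ℕ} (b : V₁ →ₗ[ℝ] V₂ →ₗ[ℝ] V) (α : Form I M V₁ 1) (β : Form I M V₂ q) :
    Form I M V (q + 1) :=
  fun x =>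
    let a : TangentSpace I x →ₗ[ℝ] V₁ :=
      (AlternatingMap.ofSubsingleton ℝ (TangentSpace I x) V₁ (0 : Fin 1)).symm (α x)
    AlternatingMap.alternatizeUncurryFin
      { toFun := fun u => (b (a u)).compAlternatingMap (β x)
        map_add' := fun u v => by ext w; simp only [map_add]; rfl
        map_smul' := fun r u => by ext w; simp only [map_smul]; rfl }

variable [FiniteDimensional ℝ E]

/-- The expression of a form in the preferred chart at `x₀`: a form on (the chart image in) the
model space `E`. -/
def inChart {q : ℕ} (η : Form I M ℝ q) (x₀ : M) : E → E [⋀^Fin q]→L[ℝ] ℝ :=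
  fun y => toContinuousAlternating
    ((η ((extChartAt I x₀).symm y)).compLinearMap
      (mfderivWithin 𝓘(ℝ, E) I (extChartAt I x₀).symm (Set.range I) y).toLinearMap)

/-- Smoothness of a form: its expression in every preferred chart is smooth. -/
def IsSmoothForm {q : ℕ} (η : Form I M ℝ q) : Prop :=
  ∀ x₀ : M, ContDiffOn ℝ ∞ (inChart η x₀) (extChartAt I x₀).target

/-- The de Rham differential, computed at `x` in the preferred chart at `x`. -/
def extD {q : ℕ} (η : Form I M ℝ q) : Form I M ℝ (q + 1) :=
  fun x => ((extDerivWithin (inChart η x) (Set.range I) (extChartAt I x x)).toAlternatingMap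
    ).compLinearMap (mfderiv I 𝓘(ℝ, E) (extChartAt I x) x).toLinearMap

/-- The Lie derivative `L_X = i_X d + d i_X`. -/
def lieD (X : (x : M) → TangentSpace I x) : (q : ℕ) → Form I M ℝ q → Form I M ℝ q
  | 0, η => contract X (extD η)
  | _ + 1, η => contract X (extD η) + extD (contract X η)

end Forms

/-! ### The nerve of a Lie group -/

/-- The `p`-th level `G^p` of the nerve. -/
abbrev Nerve (G : Type*) (p : ℕ) := Fin p → G

/-- The face maps of the nerve: `d₀` drops the first entry, the last one drops the last entry, and
`d_i` replaces `g_i, g_{i+1}` by `g_i g_{i+1}`. -/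
def face {G : Type*} [Group G] {p : ℕ} (i : Fin (p + 2)) : Nerve G (p + 1) → Nerve G p :=
  Fin.cases (fun g => Fin.tail g) (fun j g => Fin.contractNth j (· * ·) g) i

/-- The degeneracy maps of the nerve: `s_i` inserts `1` after the first `i` entries. -/
def degen {G : Type*} [Group G] {p : ℕ} (i : Fin (p + 1)) : Nerve G p → Nerve G (p + 1) :=
  fun g => i.insertNth (1 : G) g

/-- The product model with corners on `G^p`. -/
abbrev nerveModel {E : Type*} [NormedAddCommGroup E] [NormedSpace ℝ E] {H : Type*}
    [TopologicalSpace H] (I : ModelWithCorners ℝ E H) (p : ℕ) :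
    ModelWithCorners ℝ (Fin p → E) (ModelPi fun _ : Fin p => H) :=
  ModelWithCorners.pi fun _ : Fin p => I

section Nerve

variable {E : Type*} [NormedAddCommGroup E] [NormedSpace ℝ E]
  {H : Type*} [TopologicalSpace H] (I : ModelWithCorners ℝ E H)
  (G : Type*) [TopologicalSpace G] [ChartedSpace H G] [Group G]

/-- Real `q`-forms on the `p`-th level of the nerve. -/
abbrev NForm (p q : ℕ) := Form (nerveModel I p) (Nerve G p) ℝ q

variable {I G}

/-- The simplicial differential `δ = ∑ (-1)^i d_i^*`. -/
def simpD {p q : ℕ} (η : NForm I G p q) : NForm I G (p + 1) q :=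
  ∑ i : Fin (p + 2), (-1 : ℝ) ^ (i : ℕ) •
    pullback (nerveModel I (p + 1)) (nerveModel I p) (face i) η

/-- A form on the nerve is normalized if its pullbacks along all degeneracies vanish. -/
def IsNormalized : {p q : ℕ} → NForm I G p q → Prop
  | 0, _, _ => True
  | p + 1, _, η => ∀ i : Fin (p + 1),
      pullback (nerveModel I p) (nerveModel I (p + 1)) (degen i) η = 0

variable [FiniteDimensional ℝ E]

variable (I G) in
/-- The normalized forms `Ω̂^q(NG_p)`: smooth `q`-forms on `G^p` that vanish on degeneracies. -/
def normalizedForms (p q : ℕ) : Set (NForm I G p q) :=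
  {η | IsSmoothForm η ∧ IsNormalized η}

end Nerve

/-! ### The bigraded Weil algebra -/

/-- Functions of `k` odd and `q` even arguments in `𝔤`; the Weil algebra is cut out in `Weil`. -/
abbrev WeilFun (𝔤 : Type*) (k q : ℕ) := (Fin k → 𝔤) → (Fin q → 𝔤) → ℝ

section Weil

variable (𝔤 : Type*) [LieRing 𝔤] [LieAlgebra ℝ 𝔤]

/-- The component `W^{p,q} 𝔤 = Λ^{p-q} 𝔤^* ⊗ S^q 𝔤^*` of the bigraded Weil algebra (zero for
`p < q`) for finite-dimensional `𝔤`: its elements are the functions `c(a₁, …, a_{p-q} | b₁, …, b_q)`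
that are multilinear and alternating in the `a`'s and multilinear and symmetric in the `b`'s. A
symmetric `q`-linear form corresponds to the polynomial of degree `q` that is its restriction to
the diagonal. -/
def Weil (p q : ℕ) : Set (WeilFun 𝔤 (p - q) q) :=
  {c | (∀ b, ∃ f : 𝔤 [⋀^Fin (p - q)]→ₗ[ℝ] ℝ, ∀ a, c a b = f a) ∧
    (∀ a, ∃ f : MultilinearMap ℝ (fun _ : Fin q => 𝔤) ℝ, ∀ b, c a b = f b) ∧
    (∀ a b, ∀ τ : Equiv.Perm (Fin q), c a (b ∘ τ) = c a b) ∧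
    (p < q → c = 0)}

variable {𝔤}

/-- The differential `d^h`: the Chevalley-Eilenberg differential with coefficients in the `𝔤`-module
`S^q 𝔤^*`, that is, the Lie derivative along the vector field `Q = d_CE` on `𝔤[1]`. -/
def weilDh {k q : ℕ} (c : WeilFun 𝔤 k q) : WeilFun 𝔤 (k + 1) q := fun a b =>
  (∑ i : Fin (k + 1), (-1 : ℝ) ^ (i : ℕ) *
    ∑ l : Fin q, - c (i.removeNth a) (Function.update b l ⁅a i, b l⁆)) +
  ∑ j : Fin (k + 1), ∑ i : Fin k,
    if i.castSucc < j then
      (-1 : ℝ) ^ (j : ℕ) * c (Function.update (j.removeNth a) i ⁅a i.castSucc, a j⁆) b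
    else 0

/-- The differential `d^v`: the de Rham differential of `𝔤[1]`, that is, the derivation that
carries the odd generators to the even ones. On polynomials it reads
`(d^v c)(a₁, …, a_{k-1} | b) = c(b, a₁, …, a_{k-1} | b)`. -/
def weilDv : {k q : ℕ} → WeilFun 𝔤 k q → WeilFun 𝔤 (k - 1) (q + 1)
  | 0, _, _ => 0
  | k + 1, q, c => fun a b =>
      ((q : ℝ) + 1)⁻¹ * ∑ j : Fin (q + 1), c (Fin.cons (b j) a : Fin (k + 1) → 𝔤) (j.removeNth b)

/-- A bilinear form on `𝔤` as an element of `W^{2,2} 𝔤 = S² 𝔤^*`, a `2`-form of degree `2` on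
`𝔤[1]`. -/
def pairing (B : LinearMap.BilinForm ℝ 𝔤) : WeilFun 𝔤 (2 - 2) 2 := fun _ b => B (b 0) (b 1)

/-- `(𝔤[1], d_CE, η)` is a symplectic `Q`-manifold of degree `2`: the `2`-form `η ∈ W^{2,2} 𝔤` of
degree `2` is closed, invariant under `Q = d_CE`, and non-degenerate. -/
structure IsDegreeTwoSymplecticQ (η : WeilFun 𝔤 (2 - 2) 2) : Prop where
  mem : η ∈ Weil 𝔤 2 2
  closed : weilDv η = 0
  invariant : weilDh η = 0
  nondegenerate : ∀ v : 𝔤, (∀ w : 𝔤, η ![] ![v, w] = 0) → v = 0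

/-- `(𝔤, B)` is a quadratic Lie algebra. -/
structure IsQuadratic (B : LinearMap.BilinForm ℝ 𝔤) : Prop where
  symm : ∀ a b : 𝔤, B a b = B b a
  nondegenerate : ∀ a : 𝔤, (∀ b : 𝔤, B a b = 0) → a = 0
  invariant : ∀ a b c : 𝔤, B ⁅a, b⁆ c + B b ⁅a, c⁆ = 0

end Weil

/-! ### The Van Est map -/

/-- The sign of a shuffled arrangement: `-1` for each inversion, except that inversions between two
of the even letters `inr _` do not count. -/
def koszulSign {p k q : ℕ} (σ : Fin p → Fin k ⊕ Fin q) : ℝ :=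
  ∏ i : Fin p, ∏ j : Fin p,
    if i < j then
      match σ i, σ j with
      | .inl a, .inl b => if b < a then -1 else 1
      | .inl _, .inr _ => 1
      | .inr _, .inl _ => -1
      | .inr _, .inr _ => 1
    else 1

section LieGroups

variable {E : Type*} [NormedAddCommGroup E] [NormedSpace ℝ E]
  {H : Type*} [TopologicalSpace H] {I : ModelWithCorners ℝ E H}
  {G : Type*} [TopologicalSpace G] [ChartedSpace H G] [Group G]

/-- A smooth Lie group has the regularity that is needed for its Lie algebra structure. -/
instance instLieGroupMinSmoothness [LieGroup I ∞ G] : LieGroup I (minSmoothness ℝ 3) G := by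
  rw [minSmoothness_of_isRCLikeNormedField]
  infer_instance

/-- The vector field `(a^L, 0, …, 0)` on `G^(p+1)`, with `a^L` the left-invariant vector field
of `a`. -/
def hatField {p : ℕ} (a : GroupLieAlgebra I G) :
    (g : Nerve G (p + 1)) → TangentSpace (nerveModel I (p + 1)) g :=
  fun g => (fun i => if i = 0 then mulInvariantVectorField a (g i) else 0 :
    (i : Fin (p + 1)) → TangentSpace I (g i))

/-- `J_a = s₀^* i_â`. -/
def opJ {p q : ℕ} (a : GroupLieAlgebra I G) (η : NForm I G (p + 1) (q + 1)) : NForm I G p q :=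
  pullback (nerveModel I p) (nerveModel I (p + 1)) (degen 0) (contract (hatField a) η)

variable [FiniteDimensional ℝ E]

/-- `R_a = s₀^* L_â`. -/
def opR {p q : ℕ} (a : GroupLieAlgebra I G) (η : NForm I G (p + 1) q) : NForm I G p q :=
  pullback (nerveModel I p) (nerveModel I (p + 1)) (degen 0) (lieD (hatField a) q η)

/-- Apply the operators `R_a` (for a letter `inl a`) and `J_b` (for a letter `inr b`) successively,
the first letter first, to end up with a number (a function on the point `G^0`). -/
def applyWord : (p q : ℕ) → (Fin p → GroupLieAlgebra I G ⊕ GroupLieAlgebra I G) →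
    NForm I G p q → ℝ
  | 0, 0, _, η => η ![] ![]
  | 0, _ + 1, _, _ => 0
  | p + 1, 0, w, η =>
      match w 0 with
      | .inl a => applyWord p 0 (Fin.tail w) (opR a η)
      | .inr _ => 0
  | p + 1, q + 1, w, η =>
      match w 0 with
      | .inl a => applyWord p (q + 1) (Fin.tail w) (opR a η)
      | .inr b => applyWord p q (Fin.tail w) (opJ b η)

/-- The Van Est map `Ω̂^q(NG_p) → W^{p,q} 𝔤`. The sum runs over all arrangements of the operators
`R_{a₁}, …, R_{a_{p-q}}, J_{b₁}, …, J_{b_q}`; the factor `1/q!` turns it into the polarization of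
the polynomial obtained for `b₁ = ⋯ = b_q = b` from the arrangements that do not distinguish the
`q` copies of `J_b`. There are no arrangements for `p < q`, so the value is then `0`. -/
def vanEst {p q : ℕ} (η : NForm I G p q) : WeilFun (GroupLieAlgebra I G) (p - q) q := fun a b =>
  (-1 : ℝ) ^ (q * (q + 1) / 2) * ((q.factorial : ℝ)⁻¹ *
    ∑ σ : Fin p ≃ Fin (p - q) ⊕ Fin q,
      koszulSign σ * applyWord p q (fun i => Sum.map a b (σ i)) η)

/-! ### Shifted symplectic forms -/

variable (I G) in
/-- A `2`-shifted `2`-form `α₂ + α₁ + α₀` on the nerve, `α_i ∈ Ω^{4-i}(NG_i)`. -/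
structure TwoShiftedForm where
  two : NForm I G 2 2
  one : NForm I G 1 3
  zero : NForm I G 0 4

/-- The Van Est map on `2`-shifted `2`-forms, with values in
`W^{2,2} ⊕ W^{1,3} ⊕ W^{0,4}`. -/
def TwoShiftedForm.vanEst (α : TwoShiftedForm I G) :
    WeilFun (GroupLieAlgebra I G) (2 - 2) 2 × WeilFun (GroupLieAlgebra I G) (1 - 3) 3 ×
      WeilFun (GroupLieAlgebra I G) (0 - 4) 4 :=
  (VanEst.vanEst α.two, VanEst.vanEst α.one, VanEst.vanEst α.zero)

/-- The components of `α` are smooth and normalized. -/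
structure TwoShiftedForm.Normalized (α : TwoShiftedForm I G) : Prop where
  two : α.two ∈ normalizedForms I G 2 2
  one : α.one ∈ normalizedForms I G 1 3
  zero : α.zero ∈ normalizedForms I G 0 4

/-- `D α = 0` for the total differential `D = δ + (-1)^p d`. -/
structure TwoShiftedForm.Closed (α : TwoShiftedForm I G) : Prop where
  three : simpD α.two = 0
  two : simpD α.one + extD α.two = 0
  one : simpD α.zero - extD α.one = 0
  zero : extD α.zero = 0

variable (I G) in
/-- The `l`-th term of the tangent complex of the nerve: the joint kernel in `T_e G^l` of the
differentials of all faces but the last one. -/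
def tangentCx : (l : ℕ) → Submodule ℝ (TangentSpace (nerveModel I l) (1 : Nerve G l))
  | 0 => ⊤
  | l + 1 => ⨅ i : Fin (l + 1), LinearMap.ker
      (mfderiv (nerveModel I (l + 1)) (nerveModel I l) (face i.castSucc)
        (1 : Nerve G (l + 1))).toLinearMap

variable (I G) in
/-- The differential `∂ = (-1)^l T d_l` at the unit, as a map on all of `T_e G^l`. -/
def tangentBd (l : ℕ) : TangentSpace (nerveModel I (l + 1)) (1 : Nerve G (l + 1)) →ₗ[ℝ]
    TangentSpace (nerveModel I l) (1 : Nerve G l) :=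
  (-1 : ℝ) ^ (l + 1) • (mfderiv (nerveModel I (l + 1)) (nerveModel I l) (face (Fin.last (l + 1)))
    (1 : Nerve G (l + 1))).toLinearMap

variable (I G) in
/-- The `l`-cycles of the tangent complex. -/
def cycles : (l : ℕ) → Submodule ℝ (TangentSpace (nerveModel I l) (1 : Nerve G l))
  | 0 => tangentCx I G 0
  | l + 1 => tangentCx I G (l + 1) ⊓ LinearMap.ker (tangentBd I G l)

variable (I G) in
/-- The `l`-boundaries of the tangent complex. -/
def boundaries (l : ℕ) : Submodule ℝ (TangentSpace (nerveModel I l) (1 : Nerve G l)) :=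
  (tangentCx I G (l + 1)).map (tangentBd I G l)

/-- The tangent map of the degeneracy `s_i` at the unit. -/
def degenT {l : ℕ} (i : Fin (l + 1)) (v : TangentSpace (nerveModel I l) (1 : Nerve G l)) :
    TangentSpace (nerveModel I (l + 1)) (1 : Nerve G (l + 1)) :=
  mfderiv (nerveModel I l) (nerveModel I (l + 1)) (degen i) (1 : Nerve G l) v

/-- A pairing of subquotients `Z/Z₀` and `Z'/Z₀'` is non-degenerate. -/
def NondegOn {V V' : Type*} [AddCommGroup V] [Module ℝ V] [AddCommGroup V'] [Module ℝ V']
    (Z Z₀ : Submodule ℝ V) (Z' Z₀' : Submodule ℝ V') (lam : V → V' → ℝ) : Prop :=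
  (∀ v ∈ Z, (∀ w ∈ Z', lam v w = 0) → v ∈ Z₀) ∧ (∀ w ∈ Z', (∀ v ∈ Z, lam v w = 0) → w ∈ Z₀')

/-- Non-degeneracy of a `2`-shifted `2`-form: the pairings `λ` of `H_l` and `H_{2-l}` of the tangent
complex, given by sums over `(l, 2-l)`-shuffles, are non-degenerate for `l = 0, 1, 2` (all other
homology pairings are between zero groups). -/
structure TwoShiftedForm.Nondegenerate (α : TwoShiftedForm I G) : Prop where
  zero : NondegOn (cycles I G 0) (boundaries I G 0) (cycles I G 2) (boundaries I G 2)
    fun v w => α.two 1 ![degenT 1 (degenT 0 v), w]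
  one : NondegOn (cycles I G 1) (boundaries I G 1) (cycles I G 1) (boundaries I G 1)
    fun v w => α.two 1 ![degenT 1 v, degenT 0 w] - α.two 1 ![degenT 0 v, degenT 1 w]
  two : NondegOn (cycles I G 2) (boundaries I G 2) (cycles I G 0) (boundaries I G 0)
    fun v w => α.two 1 ![v, degenT 1 (degenT 0 w)]

/-- `(NG_•, α)` is `2`-shifted symplectic. -/
structure TwoShiftedForm.IsSymplectic (α : TwoShiftedForm I G) : Prop where
  normalized : α.Normalized
  closed : α.Closed
  nondegenerate : α.Nondegenerate

/-! ### The form `Ω_•` -/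

variable (I G) in
/-- The left Maurer-Cartan form `v ↦ g⁻¹ v`, as a form on `NG_1 = G`. -/
def mcLeft : Form (nerveModel I 1) (Nerve G 1) (GroupLieAlgebra I G) 1 :=
  pullback (nerveModel I 1) I (fun g : Nerve G 1 => g 0)
    (fun g : G => AlternatingMap.ofSubsingleton ℝ (TangentSpace I g) (GroupLieAlgebra I G) (0 : Fin 1)
      (mfderiv I I (fun x : G => g⁻¹ * x) g).toLinearMap)

variable (I G) in
/-- The right Maurer-Cartan form `v ↦ v g⁻¹`, as a form on `NG_1 = G`. -/
def mcRight : Form (nerveModel I 1) (Nerve G 1) (GroupLieAlgebra I G) 1 :=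
  pullback (nerveModel I 1) I (fun g : Nerve G 1 => g 0)
    (fun g : G => AlternatingMap.ofSubsingleton ℝ (TangentSpace I g) (GroupLieAlgebra I G) (0 : Fin 1)
      (mfderiv I I (fun x : G => x * g⁻¹) g).toLinearMap)

/-- The Brylinski-Weinstein `2`-form `Ω = ⟨d₂^* θ^l, d₀^* θ^r⟩` on `NG_2`. -/
def brylinskiWeinstein (B : LinearMap.BilinForm ℝ (GroupLieAlgebra I G)) : NForm I G 2 2 :=
  wedgeOne B (pullback (nerveModel I 2) (nerveModel I 1) (face 2) (mcLeft I G))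
    (pullback (nerveModel I 2) (nerveModel I 1) (face 0) (mcRight I G))

variable [CompleteSpace E] [LieGroup I ∞ G]

variable (I G) in
/-- The Lie bracket of `Lie(G)` as a bilinear map. -/
def bracketBilin : GroupLieAlgebra I G →ₗ[ℝ] GroupLieAlgebra I G →ₗ[ℝ] GroupLieAlgebra I G :=
  LinearMap.mk₂ ℝ (fun a b => ⁅a, b⁆) add_lie smul_lie lie_add (fun r a b => lie_smul r a b)

/-- The Cartan `3`-form `Θ = 1/6 ⟨θ^l, [θ^l, θ^l]⟩` on `NG_1`. -/
def cartanForm (B : LinearMap.BilinForm ℝ (GroupLieAlgebra I G)) : NForm I G 1 3 :=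
  (1 / 6 : ℝ) • wedgeOne B (mcLeft I G) (wedgeOne (bracketBilin I G) (mcLeft I G) (mcLeft I G))

/-- The `2`-shifted `2`-form `Ω_• = Ω - Θ + 0`. -/
def omegaForm (B : LinearMap.BilinForm ℝ (GroupLieAlgebra I G)) : TwoShiftedForm I G where
  two := brylinskiWeinstein B
  one := - cartanForm B
  zero := 0

variable (I) in
/-- The adjoint action `Ad_g : 𝔤 → 𝔤`, the derivative of `x ↦ g x g⁻¹` at the unit. -/
def adAction (g : G) : GroupLieAlgebra I G →ₗ[ℝ] GroupLieAlgebra I G :=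
  (mfderiv I I (fun x : G => g * x * g⁻¹) (1 : G)).toLinearMap

/-- The bilinear form is invariant under the adjoint action of the group. -/
def AdInvariant (B : LinearMap.BilinForm ℝ (GroupLieAlgebra I G)) : Prop :=
  ∀ (g : G) (a b : GroupLieAlgebra I G), B (adAction I g a) (adAction I g b) = B a b

/-- `(NG_•, α)` integrates `(𝔤[1], d_CE, η)` for `𝔤 = Lie(G)`: the former is `2`-shifted symplectic,
the latter is a symplectic `Q`-manifold of degree `2`, and the Van Est map carries the first
symplectic form to the second one, up to the sign `-1` of the convention. -/
structure Integrates (α : TwoShiftedForm I G)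
    (η : WeilFun (GroupLieAlgebra I G) (2 - 2) 2) : Prop where
  source : α.IsSymplectic
  target : IsDegreeTwoSymplecticQ η
  vanEst_eq : α.vanEst = (-η, 0, 0)

end LieGroups

end VanEst

end

/-!
The tangent spaces of `G` are all copies of the model space `E`, so the Maurer-Cartan forms are
functions `leftMC`, `rightMC` on `G` with values in the endomorphisms of `E`, and `Ω` and `Θ` have
constant coefficients in the coframes `(d₂^*θ^l, d₀^*θ^r)` of `G²` and `θ^l` of `G`
(`brylinskiWeinstein_eq_coframe`, `cartanForm_eq_coframe`). A form with constant coefficients in a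
smooth coframe is smooth, and its exterior derivative is algebraic in the structure equation of the
coframe (`extD_two_of_coframe`, `extD_three_of_coframe`). The structure equations are
`dθ^l(u, v) = -[θ^l(u), θ^l(v)]` (`fderiv_leftMC_inChart`, obtained by differentiating the constants
`θ^l(a^L) = a`) and `dθ^r(u, v) = [θ^r(u), θ^r(v)]` (`fderiv_rightMC_inChart`), which follows from
`θ^r = Ad θ^l` and the derivative of `Ad`. That the derivative of `Ad` at the unit is the bracket of
left-invariant fields (`modelDeriv_adE_one`) is the symmetry of the second derivative of the
multiplication in a chart.

Closedness is now a computation. `δΩ = 0` is the multiplicativity of the Maurer-Cartan forms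
(`leftMC_modelDeriv_mul`, `rightMC_modelDeriv_mul`) together with the `Ad`-invariance of the
pairing. In `dΩ = δΘ`, with `l = d₂^*θ^l` and `r = d₀^*θ^r`, both sides are minus the mixed terms of
the Cartan trilinear form `⟨x, [y, z]⟩` of `l + r` (`extD_brylinskiWeinstein_eval`,
`simpD_cartanForm_eval`). `dΘ = 0` is the Jacobi identity. On a connected group `Ad`-invariance
follows from the infinitesimal one, since `g ↦ ⟨Ad_g a, Ad_g b⟩` has zero derivative
(`isLocallyConstant_formE_adE`).

The tangent complex of the nerve vanishes in degrees `0` and `2` and is `𝔤` in degree `1`, where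
`Ω` induces `2⟨·,·⟩` (`brylinskiWeinstein_degenT`). Finally, `VE(Ω)` only involves the operators
`J`, and `J_c J_b Ω = ⟨b, c⟩` (`opJ_opJ_brylinskiWeinstein`), while there are no arrangements at
all in the two other components (`vanEst_eq_zero_of_lt`).
-/

noncomputable section

namespace VanEst

/-! ### Powers of a manifold -/

section Powers

variable {E : Type*} [NormedAddCommGroup E] [NormedSpace ℝ E]
  {H : Type*} [TopologicalSpace H] {I : ModelWithCorners ℝ E H}
  {G : Type*} [TopologicalSpace G] [ChartedSpace H G]
  {E' : Type*} [NormedAddCommGroup E'] [NormedSpace ℝ E']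
  {H' : Type*} [TopologicalSpace H'] {J : ModelWithCorners ℝ E' H'}
  {M : Type*} [TopologicalSpace M] [ChartedSpace H' M] {p : ℕ}

theorem range_nerveModel (I : ModelWithCorners ℝ E H) (p : ℕ) :
    Set.range (nerveModel I p) = Set.pi Set.univ fun _ => Set.range I := by
  ext y
  constructor
  · rintro ⟨x, rfl⟩ i _
    exact ⟨x i, rfl⟩
  · intro h
    choose x hx using fun i => h i (Set.mem_univ i)
    exact ⟨x, funext hx⟩

instance boundaryless_nerveModel [I.Boundaryless] : (nerveModel I p).Boundaryless where
  range_eq_univ := by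
    rw [range_nerveModel, I.range_eq_univ, Set.pi_univ]

instance isManifold_nerve {n : ℕ∞ω} [IsManifold I n G] :
    IsManifold (nerveModel I p) n (Nerve G p) := by
  refine isManifold_of_contDiffOn _ _ _ ?_
  rintro _ _ ⟨e, he, rfl⟩ ⟨e', he', rfl⟩
  rw [contDiffOn_pi]
  intro i
  have h : ContDiffOn ℝ n (I ∘ ((e i).symm.trans (e' i)) ∘ I.symm)
      (I.symm ⁻¹' ((e i).symm.trans (e' i)).source ∩ Set.range I) :=
    (mem_groupoid_of_pregroupoid.1
      (HasGroupoid.compatible (G := contDiffGroupoid n I) (he i (Set.mem_univ i))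
        (he' i (Set.mem_univ i)))).1
  have h' := h.comp (contDiff_apply ℝ E i).contDiffOn (s := {y : Fin p → E |
    y i ∈ I.symm ⁻¹' ((e i).symm.trans (e' i)).source ∩ Set.range I}) fun y hy => hy
  refine h'.mono ?_
  rintro y ⟨hy, x, rfl⟩
  refine ⟨?_, x i, rfl⟩
  exact ⟨hy.1 i (Set.mem_univ i), hy.2 i (Set.mem_univ i)⟩

theorem extChartAt_nerve_target (g : Nerve G p) :
    (extChartAt (nerveModel I p) g).target =
      Set.pi Set.univ fun i => (extChartAt I (g i)).target := by
  ext y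
  simp only [extChartAt_target, Set.mem_inter_iff, Set.mem_pi, Set.mem_univ, true_implies,
    Set.mem_preimage, range_nerveModel]
  constructor
  · rintro ⟨h1, h2⟩ i
    exact ⟨h1 i (Set.mem_univ i), h2 i⟩
  · intro h
    exact ⟨fun i _ => (h i).1, fun i => (h i).2⟩

/-- A map into a power of a manifold is differentiable if its components are. -/
theorem hasMFDerivAt_nerve {f : M → Nerve G p} {x : M} {f' : Fin p → E' →L[ℝ] E}
    (h : ∀ i, HasMFDerivAt J I (fun y => f y i) x (f' i)) :
    HasMFDerivAt J (nerveModel I p) f x (ContinuousLinearMap.pi f' : E' →L[ℝ] (Fin p → E)) := by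
  refine ⟨continuousAt_pi.2 fun i => (h i).1, ?_⟩
  exact hasFDerivWithinAt_pi.2 fun i => (h i).2

theorem hasMFDerivAt_nerve_apply (g : Nerve G p) (i : Fin p) :
    HasMFDerivAt (nerveModel I p) I (fun y : Nerve G p => y i) g
      (ContinuousLinearMap.proj i : (Fin p → E) →L[ℝ] E) := by
  refine ⟨(continuous_apply i).continuousAt, ?_⟩
  refine (ContinuousLinearMap.proj (R := ℝ) (φ := fun _ : Fin p => E)
    i).hasFDerivWithinAt.congr_of_eventuallyEq ?_ ?_
  · have := extChartAt_target_mem_nhdsWithin (I := nerveModel I p) g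
    filter_upwards [this] with y hy
    rw [extChartAt_nerve_target] at hy
    exact (extChartAt I (g i)).right_inv (hy i (Set.mem_univ i))
  · exact (extChartAt I (g i)).right_inv (mem_extChartAt_target (g i))

theorem mfderiv_nerve_apply {f : M → Nerve G p} {x : M}
    (h : ∀ i, MDifferentiableAt J I (fun y => f y i) x) (v : TangentSpace J x) (i : Fin p) :
    (mfderiv J (nerveModel I p) f x v : Fin p → E) i = mfderiv J I (fun y => f y i) x v := by
  rw [(hasMFDerivAt_nerve fun i => (h i).hasMFDerivAt).mfderiv]
  rfl

end Powers

/-! ### Forms with constant coefficients in a moving coframe -/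

section Coframe

variable {E : Type*} [NormedAddCommGroup E] [NormedSpace ℝ E]
  {F : Type*} [NormedAddCommGroup F] [NormedSpace ℝ F]

/-- Smoothness of a map into alternating forms on a finite-dimensional space may be tested on
constant arguments. -/
theorem contDiffOn_alternating_of_apply [FiniteDimensional ℝ E] {q : ℕ} {n : ℕ∞ω}
    {f : F → E [⋀^Fin q]→L[ℝ] ℝ} {s : Set F}
    (h : ∀ v : Fin q → E, ContDiffOn ℝ n (fun y => f y v) s) : ContDiffOn ℝ n f s := by
  let b := Module.finBasis ℝ E
  let ev : (E [⋀^Fin q]→L[ℝ] ℝ) →ₗ[ℝ] ((Fin q → Fin (Module.finrank ℝ E)) → ℝ) :=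
    { toFun := fun g r => g fun i => b (r i)
      map_add' := fun _ _ => rfl
      map_smul' := fun _ _ => rfl }
  have hev : LinearMap.ker ev = ⊥ := by
    refine LinearMap.ker_eq_bot.2 fun g g' hg => ?_
    apply ContinuousAlternatingMap.toAlternatingMap_injective
    exact b.ext_alternating fun r _ => congrFun hg r
  obtain ⟨inv, hinv⟩ := ev.exists_leftInverse_of_injective hev
  have hcomp : f = fun y => inv.toContinuousLinearMap (ev (f y)) := by
    funext y
    exact (LinearMap.congr_fun hinv (f y)).symm
  rw [hcomp]
  exact inv.toContinuousLinearMap.contDiff.comp_contDiffOn (contDiffOn_pi.2 fun r => h _)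

theorem contDiff_alternating_apply [FiniteDimensional ℝ F] {q : ℕ} {n : ℕ∞ω}
    (κ : F [⋀^Fin q]→ₗ[ℝ] ℝ) : ContDiff ℝ n fun v : Fin q → F => κ v :=
  (toContinuousAlternating κ).toContinuousMultilinearMap.contDiff

theorem fderiv_alternating_apply [FiniteDimensional ℝ F] {q : ℕ} (κ : F [⋀^Fin q]→ₗ[ℝ] ℝ)
    {P : E → E →L[ℝ] F} {y : E} (hP : DifferentiableAt ℝ P y) (v : Fin q → E) (u : E) :
    fderiv ℝ (fun z => κ fun i => P z (v i)) y u =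
      ∑ i, κ (Function.update (fun j => P y (v j)) i (fderiv ℝ P y u (v i))) := by
  have h1 : HasFDerivAt (fun z => fun i => P z (v i))
      (ContinuousLinearMap.pi fun i => (fderiv ℝ P y).flip (v i)) y :=
    hasFDerivAt_pi.2 fun i => by
      simpa using hP.hasFDerivAt.clm_apply (hasFDerivAt_const (v i) y)
  have h2 := ((toContinuousAlternating κ).toContinuousMultilinearMap.hasFDerivAt
    (fun i => P y (v i))).comp y h1
  have h3 : HasFDerivAt (fun z => κ fun i => P z (v i)) _ y := h2
  rw [h3.fderiv]
  simp [ContinuousMultilinearMap.linearDeriv_apply]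
  rfl

theorem map_pair_swap {q : AlternatingMap ℝ F ℝ (Fin 2)} (x y : F) : q ![x, y] = - q ![y, x] := by
  have := q.map_swap ![y, x] (i := 0) (j := 1) (by decide)
  rw [← this]
  congr 1
  ext i
  fin_cases i <;> rfl

theorem map_triple_swap₁ {q : AlternatingMap ℝ F ℝ (Fin 3)} (x y z : F) :
    q ![x, y, z] = - q ![y, x, z] := by
  have := q.map_swap ![y, x, z] (i := 0) (j := 1) (by decide)
  rw [← this]
  congr 1
  ext i
  fin_cases i <;> rfl

theorem map_triple_swap₂ {q : AlternatingMap ℝ F ℝ (Fin 3)} (x y z : F) :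
    q ![x, y, z] = - q ![x, z, y] := by
  have := q.map_swap ![x, z, y] (i := 1) (j := 2) (by decide)
  rw [← this]
  congr 1
  ext i
  fin_cases i <;> rfl

/-- The exterior derivative of the pullback of a constant `2`-form along a `1`-form `P` whose
exterior derivative at `y` is `K(P, P)`. -/
theorem extDeriv_two_of_coframe [FiniteDimensional ℝ E] [FiniteDimensional ℝ F]
    (κ : F [⋀^Fin 2]→ₗ[ℝ] ℝ) {P : E → E →L[ℝ] F} {y : E} (hP : DifferentiableAt ℝ P y)
    {K : F → F → F}
    (hK : ∀ u v, fderiv ℝ P y u v - fderiv ℝ P y v u = K (P y u) (P y v))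
    {η : E → E [⋀^Fin 2]→L[ℝ] ℝ} (hη : DifferentiableAt ℝ η y)
    (h : ∀ᶠ z in 𝓝 y, ∀ v, η z v = κ fun i => P z (v i)) (v : Fin 3 → E) :
    extDeriv η y v = κ ![K (P y (v 0)) (P y (v 1)), P y (v 2)]
      - κ ![K (P y (v 0)) (P y (v 2)), P y (v 1)]
      + κ ![K (P y (v 1)) (P y (v 2)), P y (v 0)] := by
  have key : ∀ (w : Fin 2 → E) (u : E), fderiv ℝ (fun z => η z w) y u =
      κ ![fderiv ℝ P y u (w 0), P y (w 1)] + κ ![P y (w 0), fderiv ℝ P y u (w 1)] := by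
    intro w u
    have he : (fun z => η z w) =ᶠ[𝓝 y] fun z => κ fun i => P z (w i) := by
      filter_upwards [h] with z hz using hz w
    rw [he.fderiv_eq, fderiv_alternating_apply κ hP, Fin.sum_univ_two]
    congr 2 <;> (ext i; fin_cases i <;> rfl)
  have sub₁ : ∀ a b c, κ ![a - b, c] = κ ![a, c] - κ ![b, c] := by
    intro a b c
    have e : ∀ x, Function.update ![0, c] 0 x = ![x, c] := fun x => by
      ext i; fin_cases i <;> rfl
    simpa only [e] using κ.map_update_sub ![0, c] 0 a b
  rw [extDeriv_apply hη, Fin.sum_univ_three, key, key, key, ← hK, ← hK, ← hK, sub₁, sub₁, sub₁]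
  have e00 : (Fin.removeNth 0 v) 0 = v 1 := rfl
  have e01 : (Fin.removeNth 0 v) 1 = v 2 := rfl
  have e10 : (Fin.removeNth 1 v) 0 = v 0 := rfl
  have e11 : (Fin.removeNth 1 v) 1 = v 2 := rfl
  have e20 : (Fin.removeNth 2 v) 0 = v 0 := rfl
  have e21 : (Fin.removeNth 2 v) 1 = v 1 := rfl
  rw [e00, e01, e10, e11, e20, e21]
  simp only [Fin.val_zero, Fin.val_one, Fin.val_two, pow_zero, pow_one]
  rw [map_pair_swap (P y (v 1)), map_pair_swap (P y (v 0)) (fderiv ℝ P y (v 1) (v 2)),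
    map_pair_swap (P y (v 0)) (fderiv ℝ P y (v 2) (v 1))]
  ring

/-- The exterior derivative of the pullback of a constant `3`-form along a `1`-form `P` whose
exterior derivative at `y` is `K(P, P)`. -/
theorem extDeriv_three_of_coframe [FiniteDimensional ℝ E] [FiniteDimensional ℝ F]
    (κ : F [⋀^Fin 3]→ₗ[ℝ] ℝ) {P : E → E →L[ℝ] F} {y : E} (hP : DifferentiableAt ℝ P y)
    {K : F → F → F}
    (hK : ∀ u v, fderiv ℝ P y u v - fderiv ℝ P y v u = K (P y u) (P y v))
    {η : E → E [⋀^Fin 3]→L[ℝ] ℝ} (hη : DifferentiableAt ℝ η y)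
    (h : ∀ᶠ z in 𝓝 y, ∀ v, η z v = κ fun i => P z (v i)) (v : Fin 4 → E) :
    extDeriv η y v =
      κ ![K (P y (v 0)) (P y (v 1)), P y (v 2), P y (v 3)]
      - κ ![K (P y (v 0)) (P y (v 2)), P y (v 1), P y (v 3)]
      + κ ![K (P y (v 0)) (P y (v 3)), P y (v 1), P y (v 2)]
      + κ ![K (P y (v 1)) (P y (v 2)), P y (v 0), P y (v 3)]
      - κ ![K (P y (v 1)) (P y (v 3)), P y (v 0), P y (v 2)]
      + κ ![K (P y (v 2)) (P y (v 3)), P y (v 0), P y (v 1)] := by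
  have key : ∀ (w : Fin 3 → E) (u : E), fderiv ℝ (fun z => η z w) y u =
      κ ![fderiv ℝ P y u (w 0), P y (w 1), P y (w 2)]
      - κ ![fderiv ℝ P y u (w 1), P y (w 0), P y (w 2)]
      + κ ![fderiv ℝ P y u (w 2), P y (w 0), P y (w 1)] := by
    intro w u
    have he : (fun z => η z w) =ᶠ[𝓝 y] fun z => κ fun i => P z (w i) := by
      filter_upwards [h] with z hz using hz w
    rw [he.fderiv_eq, fderiv_alternating_apply κ hP, Fin.sum_univ_three,
      map_triple_swap₁ (fderiv ℝ P y u (w 1)), map_triple_swap₁ (fderiv ℝ P y u (w 2)),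
      map_triple_swap₂ (P y (w 0)) (fderiv ℝ P y u (w 2)), neg_neg, sub_neg_eq_add]
    congr 1
    · congr 1 <;> (congr 1; ext i; fin_cases i <;> rfl)
    · congr 1; ext i; fin_cases i <;> rfl
  have sub₁ : ∀ a b c d, κ ![a - b, c, d] = κ ![a, c, d] - κ ![b, c, d] := by
    intro a b c d
    have e : ∀ x, Function.update ![0, c, d] 0 x = ![x, c, d] := fun x => by
      ext i; fin_cases i <;> rfl
    simpa only [e] using κ.map_update_sub ![0, c, d] 0 a b
  rw [extDeriv_apply hη, Fin.sum_univ_four]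
  simp only [key, ← hK, sub₁]
  have e00 : (Fin.removeNth 0 v) 0 = v 1 := rfl
  have e01 : (Fin.removeNth 0 v) 1 = v 2 := rfl
  have e02 : (Fin.removeNth 0 v) 2 = v 3 := rfl
  have e10 : (Fin.removeNth 1 v) 0 = v 0 := rfl
  have e11 : (Fin.removeNth 1 v) 1 = v 2 := rfl
  have e12 : (Fin.removeNth 1 v) 2 = v 3 := rfl
  have e20 : (Fin.removeNth 2 v) 0 = v 0 := rfl
  have e21 : (Fin.removeNth 2 v) 1 = v 1 := rfl
  have e22 : (Fin.removeNth 2 v) 2 = v 3 := rfl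
  have e30 : (Fin.removeNth 3 v) 0 = v 0 := rfl
  have e31 : (Fin.removeNth 3 v) 1 = v 1 := rfl
  have e32 : (Fin.removeNth 3 v) 2 = v 2 := rfl
  have v3 : ((3 : Fin 4) : ℕ) = 3 := rfl
  rw [e00, e01, e02, e10, e11, e12, e20, e21, e22, e30, e31, e32, v3]
  simp only [Fin.val_zero, Fin.val_one, Fin.val_two, pow_zero, pow_one]
  ring

variable {H : Type*} [TopologicalSpace H] {I : ModelWithCorners ℝ E H}
  {M : Type*} [TopologicalSpace M] [ChartedSpace H M]

variable (I) in
/-- The expression in the preferred chart at `x₀` of an `F`-valued `1`-form `T`, whose values are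
read as maps on the model space. -/
def coframeInChart (T : M → E →L[ℝ] F) (x₀ : M) (y : E) : E →L[ℝ] F :=
  (T ((extChartAt I x₀).symm y)).comp
    (mfderivWithin 𝓘(ℝ, E) I (extChartAt I x₀).symm (Set.range I) y : E →L[ℝ] E)

theorem inChart_of_coframe [FiniteDimensional ℝ E] {q : ℕ} {κ : F [⋀^Fin q]→ₗ[ℝ] ℝ}
    {T : M → E →L[ℝ] F} {η : Form I M ℝ q}
    (hη : ∀ x (v : Fin q → E), η x v = κ fun i => T x (v i)) (x₀ : M) (y : E) (v : Fin q → E) :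
    inChart η x₀ y v = κ fun i => coframeInChart I T x₀ y (v i) :=
  hη _ _

/-- A form with constant coefficients in a smooth coframe is smooth. -/
theorem contDiffOn_inChart_of_coframe [FiniteDimensional ℝ E] [FiniteDimensional ℝ F] {q : ℕ}
    {κ : F [⋀^Fin q]→ₗ[ℝ] ℝ}
    {T : M → E →L[ℝ] F} {η : Form I M ℝ q} {x₀ : M}
    (hη : ∀ x (v : Fin q → E), η x v = κ fun i => T x (v i))
    (hT : ContDiffOn ℝ ∞ (coframeInChart I T x₀) (extChartAt I x₀).target) :
    ContDiffOn ℝ ∞ (inChart η x₀) (extChartAt I x₀).target := by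
  refine contDiffOn_alternating_of_apply fun v => ?_
  simp only [inChart_of_coframe hη]
  exact (contDiff_alternating_apply κ).comp_contDiffOn
    (contDiffOn_pi.2 fun i => hT.clm_apply contDiffOn_const)

/-- The chart expression at the base point, precomposed with the differential of the chart, is the
original `1`-form. -/
theorem coframeInChart_mfderiv_extChartAt [IsManifold I 1 M] (T : M → E →L[ℝ] F) (x : M) (v : E) :
    coframeInChart I T x (extChartAt I x x) (mfderiv I 𝓘(ℝ, E) (extChartAt I x) x v : E) =
      T x v := by
  have h := mfderivWithin_extChartAt_symm_comp_mfderiv_extChartAt' (I := I)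
    (mem_extChartAt_source (I := I) x)
  have h' := congrArg (fun L : E →L[ℝ] E => L v) h
  rw [coframeInChart, extChartAt_to_inv]
  exact congrArg (T x) h'

theorem differentiableAt_of_contDiffOn_target {W : Type*} [NormedAddCommGroup W] [NormedSpace ℝ W]
    [I.Boundaryless] {x : M} {f : E → W} (hf : ContDiffOn ℝ ∞ f (extChartAt I x).target) :
    DifferentiableAt ℝ f (extChartAt I x x) :=
  (hf.contDiffAt ((isOpen_extChartAt_target x).mem_nhds
    (mem_extChartAt_target x))).differentiableAt (by simp)

variable [FiniteDimensional ℝ E] [FiniteDimensional ℝ F] [I.Boundaryless] [IsManifold I 1 M]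
  {T : M → E →L[ℝ] F} {x : M}

/-- The de Rham differential of a `2`-form with constant coefficients `κ` in a coframe `T` with the
structure equation `dT = K(T, T)`. -/
theorem extD_two_of_coframe {κ : F [⋀^Fin 2]→ₗ[ℝ] ℝ} {η : Form I M ℝ 2}
    (hη : ∀ x (v : Fin 2 → E), η x v = κ fun i => T x (v i))
    (hT : ContDiffOn ℝ ∞ (coframeInChart I T x) (extChartAt I x).target)
    {K : F → F → F}
    (hK : ∀ u v, fderiv ℝ (coframeInChart I T x) (extChartAt I x x) u v
      - fderiv ℝ (coframeInChart I T x) (extChartAt I x x) v u =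
        K (coframeInChart I T x (extChartAt I x x) u) (coframeInChart I T x (extChartAt I x x) v))
    (v : Fin 3 → E) :
    extD η x v = κ ![K (T x (v 0)) (T x (v 1)), T x (v 2)]
      - κ ![K (T x (v 0)) (T x (v 2)), T x (v 1)]
      + κ ![K (T x (v 1)) (T x (v 2)), T x (v 0)] := by
  have h := extDeriv_two_of_coframe κ (differentiableAt_of_contDiffOn_target hT) hK
    (differentiableAt_of_contDiffOn_target (contDiffOn_inChart_of_coframe hη hT))
    (Filter.Eventually.of_forall fun z w => inChart_of_coframe hη x z w)
    (fun i => (mfderiv I 𝓘(ℝ, E) (extChartAt I x) x (v i) : E))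
  simp only [coframeInChart_mfderiv_extChartAt] at h
  rw [← h, extD, I.range_eq_univ, extDerivWithin_univ]
  rfl

/-- The de Rham differential of a `3`-form with constant coefficients `κ` in a coframe `T` with the
structure equation `dT = K(T, T)`. -/
theorem extD_three_of_coframe {κ : F [⋀^Fin 3]→ₗ[ℝ] ℝ} {η : Form I M ℝ 3}
    (hη : ∀ x (v : Fin 3 → E), η x v = κ fun i => T x (v i))
    (hT : ContDiffOn ℝ ∞ (coframeInChart I T x) (extChartAt I x).target)
    {K : F → F → F}
    (hK : ∀ u v, fderiv ℝ (coframeInChart I T x) (extChartAt I x x) u v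
      - fderiv ℝ (coframeInChart I T x) (extChartAt I x x) v u =
        K (coframeInChart I T x (extChartAt I x x) u) (coframeInChart I T x (extChartAt I x x) v))
    (v : Fin 4 → E) :
    extD η x v =
      κ ![K (T x (v 0)) (T x (v 1)), T x (v 2), T x (v 3)]
      - κ ![K (T x (v 0)) (T x (v 2)), T x (v 1), T x (v 3)]
      + κ ![K (T x (v 0)) (T x (v 3)), T x (v 1), T x (v 2)]
      + κ ![K (T x (v 1)) (T x (v 2)), T x (v 0), T x (v 3)]
      - κ ![K (T x (v 1)) (T x (v 3)), T x (v 0), T x (v 2)]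
      + κ ![K (T x (v 2)) (T x (v 3)), T x (v 0), T x (v 1)] := by
  have h := extDeriv_three_of_coframe κ (differentiableAt_of_contDiffOn_target hT) hK
    (differentiableAt_of_contDiffOn_target (contDiffOn_inChart_of_coframe hη hT))
    (Filter.Eventually.of_forall fun z w => inChart_of_coframe hη x z w)
    (fun i => (mfderiv I 𝓘(ℝ, E) (extChartAt I x) x (v i) : E))
  simp only [coframeInChart_mfderiv_extChartAt] at h
  rw [← h, extD, I.range_eq_univ, extDerivWithin_univ]
  rfl

end Coframe

/-! ### Maurer-Cartan forms and the adjoint action -/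

section Calculus

variable {E : Type*} [NormedAddCommGroup E] [NormedSpace ℝ E]
  {H : Type*} [TopologicalSpace H] {I : ModelWithCorners ℝ E H}
  {M : Type*} [TopologicalSpace M] [ChartedSpace H M]
  {E' : Type*} [NormedAddCommGroup E'] [NormedSpace ℝ E']
  {H' : Type*} [TopologicalSpace H'] {I' : ModelWithCorners ℝ E' H'}
  {M' : Type*} [TopologicalSpace M'] [ChartedSpace H' M']
  {E'' : Type*} [NormedAddCommGroup E''] [NormedSpace ℝ E'']
  {H'' : Type*} [TopologicalSpace H''] {I'' : ModelWithCorners ℝ E'' H''}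
  {M'' : Type*} [TopologicalSpace M''] [ChartedSpace H'' M'']

variable (I I') in
/-- The derivative of a map of manifolds, read as a map between the model spaces. Its type does not
mention the base point, so that base points may be rewritten freely. -/
def modelDeriv (f : M → M') (x : M) : E →L[ℝ] E' := mfderiv I I' f x

theorem modelDeriv_comp {f : M → M'} {g : M' → M''} {x : M} {y : M'} (hy : f x = y)
    (hg : MDifferentiableAt I' I'' g y) (hf : MDifferentiableAt I I' f x) (v : E) :
    modelDeriv I I'' (fun z => g (f z)) x v = modelDeriv I' I'' g y (modelDeriv I I' f x v) := by
  subst hy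
  exact mfderiv_comp_apply x hg hf v

theorem modelDeriv_id (x : M) : modelDeriv I I (fun y : M => y) x = ContinuousLinearMap.id ℝ E :=
  mfderiv_id

theorem modelDeriv_prod {f : M × M' → M''} {p : M × M'}
    (hf : MDifferentiableAt (I.prod I') I'' f p) (v : E × E') :
    modelDeriv (I.prod I') I'' f p v = modelDeriv I I'' (fun z => f (z, p.2)) p.1 v.1 +
      modelDeriv I' I'' (fun z => f (p.1, z)) p.2 v.2 :=
  mfderiv_prod_eq_add_apply hf

theorem modelDeriv_prodMk {f : M → M'} {g : M → M''} {x : M}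
    (hf : MDifferentiableAt I I' f x) (hg : MDifferentiableAt I I'' g x) (v : E) :
    modelDeriv I (I'.prod I'') (fun y => (f y, g y)) x v =
      (modelDeriv I I' f x v, modelDeriv I I'' g x v) := by
  rw [modelDeriv, mfderiv_prodMk hf hg]
  rfl

/-- If `f` and `g` stay in points with the same preferred charts, `inTangentCoordinates` changes
nothing. -/
theorem inTangentCoordinates_of_achart_eq {N : Type*} [IsManifold I 1 M] [IsManifold I' 1 M']
    {f : N → M} {g : N → M'} {ϕ : N → E →L[ℝ] E'} {x₀ x : N}
    (hf : achart H (f x) = achart H (f x₀)) (hg : achart H' (g x) = achart H' (g x₀)) :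
    inTangentCoordinates I I' f g ϕ x₀ x = ϕ x := by
  have hfx : f x ∈ (chartAt H (f x₀)).source := by
    have := mem_chart_source H (f x)
    rwa [← coe_achart, hf] at this
  have hgx : g x ∈ (chartAt H' (g x₀)).source := by
    have := mem_chart_source H' (g x)
    rwa [← coe_achart, hg] at this
  rw [inTangentCoordinates_eq _ _ _ hfx hgx, hf, hg]
  ext v
  have h1 := (tangentBundleCore I M).coordChange_self (achart H (f x₀)) (f x) hfx v
  have h2 := (tangentBundleCore I' M').coordChange_self (achart H' (g x₀)) (g x) hgx (ϕ x v)
  simp only [ContinuousLinearMap.comp_apply]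
  rw [h1, h2]

/-- The derivative of a family of maps at a point depending on the parameter depends smoothly on
the parameter, as soon as the tangent spaces involved are read in the same charts. -/
theorem contMDiffAt_modelDeriv [IsManifold I 1 M] [IsManifold I' 1 M'] [IsManifold I'' 1 M'']
    {f : M → M' → M''} {g : M → M'} {x₀ : M}
    (hf : ContMDiffAt (I.prod I') I'' ∞ (Function.uncurry f) (x₀, g x₀))
    (hg : ContMDiffAt I I' ∞ g x₀)
    (h₁ : ∀ x, achart H' (g x) = achart H' (g x₀))
    (h₂ : ∀ x, achart H'' (f x (g x)) = achart H'' (f x₀ (g x₀))) :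
    ContMDiffAt I 𝓘(ℝ, E' →L[ℝ] E'') ∞ (fun x => modelDeriv I' I'' (f x) (g x)) x₀ := by
  have h := ContMDiffAt.mfderiv (m := ∞) (n := ∞) f g hf hg (by simp)
  refine h.congr_of_eventuallyEq (Filter.Eventually.of_forall fun x => ?_)
  exact (inTangentCoordinates_of_achart_eq (ϕ := fun x => modelDeriv I' I'' (f x) (g x))
    (h₁ x) (h₂ x)).symm

end Calculus

section LieGroups

variable {E : Type*} [NormedAddCommGroup E] [NormedSpace ℝ E]
  {H : Type*} [TopologicalSpace H] {I : ModelWithCorners ℝ E H}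
  {G : Type*} [TopologicalSpace G] [ChartedSpace H G] [Group G]

variable (I) in
/-- The left Maurer-Cartan form, read in the model space. -/
def leftMC (g : G) : E →L[ℝ] E := modelDeriv I I (fun x : G => g⁻¹ * x) g

variable (I) in
/-- The right Maurer-Cartan form, read in the model space. -/
def rightMC (g : G) : E →L[ℝ] E := modelDeriv I I (fun x : G => x * g⁻¹) g

variable (I) in
/-- The adjoint action, read in the model space. -/
def adE (g : G) : E →L[ℝ] E := modelDeriv I I (fun x : G => g * x * g⁻¹) 1

theorem leftMC_one : leftMC I (1 : G) = ContinuousLinearMap.id ℝ E := by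
  have : (fun x : G => (1 : G)⁻¹ * x) = fun x => x := by funext x; simp
  rw [leftMC, this, modelDeriv_id]

theorem rightMC_one : rightMC I (1 : G) = ContinuousLinearMap.id ℝ E := by
  have : (fun x : G => x * (1 : G)⁻¹) = fun x => x := by funext x; simp
  rw [rightMC, this, modelDeriv_id]

theorem adE_one : adE I (1 : G) = ContinuousLinearMap.id ℝ E := by
  have : (fun x : G => 1 * x * (1 : G)⁻¹) = fun x => x := by funext x; simp
  rw [adE, this, modelDeriv_id]

variable [LieGroup I ∞ G]

instance isManifold_one_of_lieGroup : IsManifold I 1 G :=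
  have : IsManifold I ∞ G := ContMDiffMul.toIsManifold
  IsManifold.of_le (n := ∞) (by simp)

theorem mdifferentiable_mul_left (g : G) : MDifferentiable I I fun x : G => g * x :=
  (contMDiff_mul_left (n := ∞)).mdifferentiable (by simp)

theorem mdifferentiable_mul_right (g : G) : MDifferentiable I I fun x : G => x * g :=
  (contMDiff_mul_right (n := ∞)).mdifferentiable (by simp)

theorem mdifferentiable_conj (g : G) : MDifferentiable I I fun x : G => g * x * g⁻¹ :=
  (mdifferentiable_mul_right g⁻¹).comp (mdifferentiable_mul_left g)

theorem leftMC_mul_left (g h : G) (v : E) :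
    leftMC I (g * h) (modelDeriv I I (fun x : G => g * x) h v) = leftMC I h v := by
  have := modelDeriv_comp (I := I) (I' := I) (I'' := I) (x := h) (f := fun x => g * x)
    (g := fun x => (g * h)⁻¹ * x) rfl (mdifferentiable_mul_left _ _)
    (mdifferentiable_mul_left _ _) v
  rw [leftMC, ← this, leftMC]
  congr 2
  funext x
  group

theorem rightMC_mul_right (g h : G) (v : E) :
    rightMC I (g * h) (modelDeriv I I (fun x : G => x * h) g v) = rightMC I g v := by
  have := modelDeriv_comp (I := I) (I' := I) (I'' := I) (x := g) (f := fun x => x * h)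
    (g := fun x => x * (g * h)⁻¹) rfl (mdifferentiable_mul_right _ _)
    (mdifferentiable_mul_right _ _) v
  rw [rightMC, ← this, rightMC]
  congr 2
  funext x
  group

theorem rightMC_eq (g : G) (v : E) : rightMC I g v = adE I g (leftMC I g v) := by
  have := modelDeriv_comp (I := I) (I' := I) (I'' := I) (x := g) (f := fun x => g⁻¹ * x)
    (g := fun x => g * x * g⁻¹) (inv_mul_cancel g) (mdifferentiable_conj _ _)
    (mdifferentiable_mul_left _ _) v
  rw [adE, leftMC, ← this, rightMC]
  congr 2
  funext x
  group

theorem adE_mul (g h : G) (v : E) : adE I (g * h) v = adE I g (adE I h v) := by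
  have := modelDeriv_comp (I := I) (I' := I) (I'' := I) (x := (1 : G))
    (f := fun x => h * x * h⁻¹)
    (g := fun x => g * x * g⁻¹) (y := 1) (by group) (mdifferentiable_conj _ _)
    (mdifferentiable_conj _ _) v
  rw [adE, adE, adE, ← this]
  congr 2
  funext x
  group

theorem adE_inv_apply_self (g : G) (v : E) : adE I g⁻¹ (adE I g v) = v := by
  rw [← adE_mul, inv_mul_cancel, adE_one, ContinuousLinearMap.id_apply]

theorem adE_self_apply_inv (g : G) (v : E) : adE I g (adE I g⁻¹ v) = v := by
  rw [← adE_mul, mul_inv_cancel, adE_one, ContinuousLinearMap.id_apply]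

theorem leftMC_eq (g : G) (v : E) : leftMC I g v = adE I g⁻¹ (rightMC I g v) := by
  rw [rightMC_eq, adE_inv_apply_self]

theorem leftMC_mul_right (g h : G) (v : E) :
    leftMC I (g * h) (modelDeriv I I (fun x : G => x * h) g v) = adE I h⁻¹ (leftMC I g v) := by
  rw [leftMC_eq, rightMC_mul_right, leftMC_eq, ← adE_mul, mul_inv_rev]

theorem rightMC_mul_left (g h : G) (v : E) :
    rightMC I (g * h) (modelDeriv I I (fun x : G => g * x) h v) = adE I g (rightMC I h v) := by
  rw [rightMC_eq, leftMC_mul_left, rightMC_eq, ← adE_mul]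

theorem leftMC_mulInvariantVectorField (g : G) (a : GroupLieAlgebra I G) :
    leftMC I g (mulInvariantVectorField a g : E) = (a : E) := by
  have := leftMC_mul_left (I := I) g 1 a
  rw [mul_one, leftMC_one] at this
  exact this

/-- The left Maurer-Cartan form is a pointwise isomorphism, with inverse given by the left-invariant
vector fields. -/
theorem mulInvariantVectorField_leftMC (g : G) (v : E) :
    (mulInvariantVectorField (I := I) (leftMC I g v : E) g : E) = v := by
  have := modelDeriv_comp (I := I) (I' := I) (I'' := I) (x := g) (f := fun x => g⁻¹ * x)
    (g := fun x => g * x) (inv_mul_cancel g) (mdifferentiable_mul_left _ _)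
    (mdifferentiable_mul_left _ _) v
  have hid : (fun x : G => g * (g⁻¹ * x)) = fun x => x := by funext x; simp
  rw [hid, modelDeriv_id] at this
  exact this.symm

section Products

variable {E' : Type*} [NormedAddCommGroup E'] [NormedSpace ℝ E']
  {H' : Type*} [TopologicalSpace H'] {J : ModelWithCorners ℝ E' H'}
  {M : Type*} [TopologicalSpace M] [ChartedSpace H' M] {f₁ f₂ : M → G} {x : M}

theorem mdifferentiableAt_mul (h₁ : MDifferentiableAt J I f₁ x) (h₂ : MDifferentiableAt J I f₂ x) :
    MDifferentiableAt J I (fun y => f₁ y * f₂ y) x :=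
  ((contMDiff_mul I ∞).mdifferentiable (by simp) (f₁ x, f₂ x)).comp x (h₁.prodMk h₂)

theorem modelDeriv_mul (h₁ : MDifferentiableAt J I f₁ x) (h₂ : MDifferentiableAt J I f₂ x)
    (v : E') : modelDeriv J I (fun y => f₁ y * f₂ y) x v =
      modelDeriv I I (fun z => z * f₂ x) (f₁ x) (modelDeriv J I f₁ x v) +
      modelDeriv I I (fun z => f₁ x * z) (f₂ x) (modelDeriv J I f₂ x v) := by
  have hmul : MDifferentiableAt (I.prod I) I (fun p : G × G => p.1 * p.2) (f₁ x, f₂ x) :=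
    (contMDiff_mul I ∞).mdifferentiable (by simp) _
  rw [modelDeriv_comp (f := fun y => (f₁ y, f₂ y)) rfl hmul (h₁.prodMk h₂), modelDeriv_prod hmul,
    modelDeriv_prodMk h₁ h₂]

/-- `(f₁ f₂)^* θ^l = Ad_{f₂⁻¹} f₁^* θ^l + f₂^* θ^l`. -/
theorem leftMC_modelDeriv_mul (h₁ : MDifferentiableAt J I f₁ x) (h₂ : MDifferentiableAt J I f₂ x)
    (v : E') : leftMC I (f₁ x * f₂ x) (modelDeriv J I (fun y => f₁ y * f₂ y) x v) =
      adE I (f₂ x)⁻¹ (leftMC I (f₁ x) (modelDeriv J I f₁ x v)) +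
        leftMC I (f₂ x) (modelDeriv J I f₂ x v) := by
  rw [modelDeriv_mul h₁ h₂, map_add, leftMC_mul_left, leftMC_mul_right]

/-- `(f₁ f₂)^* θ^r = f₁^* θ^r + Ad_{f₁} f₂^* θ^r`. -/
theorem rightMC_modelDeriv_mul (h₁ : MDifferentiableAt J I f₁ x) (h₂ : MDifferentiableAt J I f₂ x)
    (v : E') : rightMC I (f₁ x * f₂ x) (modelDeriv J I (fun y => f₁ y * f₂ y) x v) =
      rightMC I (f₁ x) (modelDeriv J I f₁ x v) +
        adE I (f₁ x) (rightMC I (f₂ x) (modelDeriv J I f₂ x v)) := by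
  rw [modelDeriv_mul h₁ h₂, map_add, rightMC_mul_left, rightMC_mul_right]

end Products

theorem contMDiff_adE : ContMDiff I 𝓘(ℝ, E →L[ℝ] E) ∞ (adE I : G → E →L[ℝ] E) := by
  intro g
  have hf : ContMDiff (I.prod I) I ∞ (Function.uncurry fun g x : G => g * x * g⁻¹) :=
    (contMDiff_fst.mul contMDiff_snd).mul contMDiff_fst.inv
  exact contMDiffAt_modelDeriv (hf _) contMDiffAt_const (fun _ => rfl) (fun g' => by simp)

variable [I.Boundaryless]

/-- In a chart `φ` with inverse `ψ`, the form `θ^l` at `z` is the derivative of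
`w ↦ (ψ z)⁻¹ (ψ w)` at `w = z`, where the value of this map is the unit for all `z`. -/
theorem contDiffOn_leftMC_inChart (x₀ : G) :
    ContDiffOn ℝ ∞ (coframeInChart I (leftMC I) x₀) (extChartAt I x₀).target := by
  intro y hy
  apply ContDiffAt.contDiffWithinAt
  have hφ : ∀ z ∈ (extChartAt I x₀).target, ContMDiffAt 𝓘(ℝ, E) I ∞ (extChartAt I x₀).symm z :=
    fun z hz => ((contMDiffOn_extChartAt_symm x₀) z hz).contMDiffAt
      ((isOpen_extChartAt_target x₀).mem_nhds hz)
  have hf : ContMDiffAt (𝓘(ℝ, E).prod 𝓘(ℝ, E)) I ∞ (Function.uncurry fun z w : E =>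
      ((extChartAt I x₀).symm z)⁻¹ * (extChartAt I x₀).symm w) (y, y) :=
    (((hφ y hy).comp (y, y) contMDiffAt_fst).inv).mul ((hφ y hy).comp (y, y) contMDiffAt_snd)
  have h := contMDiffAt_modelDeriv hf contMDiffAt_id (fun _ => Subtype.ext rfl)
    (fun _ => by simp)
  rw [← contMDiffAt_iff_contDiffAt]
  refine h.congr_of_eventuallyEq ?_
  filter_upwards [(isOpen_extChartAt_target x₀).mem_nhds hy] with z hz
  ext v
  have := modelDeriv_comp (I := 𝓘(ℝ, E)) (I' := I) (I'' := I) (x := z)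
    (f := (extChartAt I x₀).symm) (g := fun x => ((extChartAt I x₀).symm z)⁻¹ * x) rfl
    (mdifferentiable_mul_left _ _) ((hφ z hz).mdifferentiableAt (by simp)) v
  refine Eq.trans ?_ this.symm
  rw [coframeInChart, I.range_eq_univ, mfderivWithin_univ]
  rfl

theorem contDiffOn_rightMC_inChart (x₀ : G) :
    ContDiffOn ℝ ∞ (coframeInChart I (rightMC I) x₀) (extChartAt I x₀).target := by
  have h1 : ContDiffOn ℝ ∞ (fun y => adE I ((extChartAt I x₀).symm y))
      (extChartAt I x₀).target := by
    rw [← contMDiffOn_iff_contDiffOn]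
    exact contMDiff_adE.comp_contMDiffOn (contMDiffOn_extChartAt_symm x₀)
  refine (h1.clm_comp (contDiffOn_leftMC_inChart x₀)).congr fun y _ => ?_
  ext v
  exact rightMC_eq _ _

end LieGroups

/-! ### The Maurer-Cartan equations -/

section MaurerCartan

variable {E : Type*} [NormedAddCommGroup E] [NormedSpace ℝ E]
  {H : Type*} [TopologicalSpace H] {I : ModelWithCorners ℝ E H}

section Chart

variable {M : Type*} [TopologicalSpace M] [ChartedSpace H M]

theorem coframeInChart_eq [I.Boundaryless] {F : Type*} [NormedAddCommGroup F] [NormedSpace ℝ F]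
    (T : M → E →L[ℝ] F) (x₀ : M) (y v : E) : coframeInChart I T x₀ y v =
      T ((extChartAt I x₀).symm y) (modelDeriv 𝓘(ℝ, E) I (extChartAt I x₀).symm y v) := by
  rw [coframeInChart, I.range_eq_univ, mfderivWithin_univ]
  rfl

variable (I) in
/-- The tangent space at `x` is the model space, identified with it by the preferred chart at
`x`. -/
theorem modelDeriv_extChartAt_self (x : M) :
    modelDeriv I 𝓘(ℝ, E) (extChartAt I x) x = ContinuousLinearMap.id ℝ E := by
  have h : HasMFDerivAt I 𝓘(ℝ, E) (extChartAt I x) x (ContinuousLinearMap.id ℝ E) := by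
    refine ⟨continuousAt_extChartAt x, ?_⟩
    refine (hasFDerivWithinAt_id _ _).congr_of_eventuallyEq ?_ ?_
    · filter_upwards [extChartAt_target_mem_nhdsWithin (I := I) x] with y hy
      exact (extChartAt I x).right_inv hy
    · exact (extChartAt I x).right_inv (mem_extChartAt_target x)
  exact h.mfderiv

variable [IsManifold I 1 M] [I.Boundaryless]

theorem mdifferentiableAt_extChartAt_symm {x₀ : M} {y : E} (hy : y ∈ (extChartAt I x₀).target) :
    MDifferentiableAt 𝓘(ℝ, E) I (extChartAt I x₀).symm y := by
  have := mdifferentiableWithinAt_extChartAt_symm hy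
  rwa [I.range_eq_univ, mdifferentiableWithinAt_univ] at this

variable (I) in
theorem modelDeriv_extChartAt_symm_self (x : M) :
    modelDeriv 𝓘(ℝ, E) I (extChartAt I x).symm (extChartAt I x x) = ContinuousLinearMap.id ℝ E := by
  ext v
  have h1 := mfderivWithin_extChartAt_symm_comp_mfderiv_extChartAt' (I := I)
    (mem_extChartAt_source (I := I) x)
  rw [I.range_eq_univ, mfderivWithin_univ] at h1
  have h2 : modelDeriv 𝓘(ℝ, E) I (extChartAt I x).symm (extChartAt I x x)
      (modelDeriv I 𝓘(ℝ, E) (extChartAt I x) x v) = v :=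
    congrArg (fun L : E →L[ℝ] E => L v) h1
  rwa [modelDeriv_extChartAt_self] at h2

theorem isInvertible_modelDeriv_extChartAt_symm {x₀ : M} {y : E}
    (hy : y ∈ (extChartAt I x₀).target) :
    (modelDeriv 𝓘(ℝ, E) I (extChartAt I x₀).symm y).IsInvertible := by
  have := isInvertible_mfderivWithin_extChartAt_symm hy
  rw [I.range_eq_univ, mfderivWithin_univ] at this
  exact this

theorem coframeInChart_self {F : Type*} [NormedAddCommGroup F] [NormedSpace ℝ F]
    (T : M → E →L[ℝ] F) (x : M) (v : E) :
    coframeInChart I T x (extChartAt I x x) v = T x v := by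
  rw [coframeInChart_eq, modelDeriv_extChartAt_symm_self, extChartAt_to_inv]
  rfl

end Chart

variable {G : Type*} [TopologicalSpace G] [ChartedSpace H G] [Group G]

variable (I G) in
/-- The bracket of the Lie algebra of `G`, read in the model space. -/
def brE : E → E → E := fun a b : GroupLieAlgebra I G => (⁅a, b⁆ : GroupLieAlgebra I G)

variable (I) in
/-- The left-invariant vector field of `a` in the preferred chart at `x₀`. -/
def leftFieldInChart (x₀ : G) (a : E) (y : E) : E :=
  (modelDeriv 𝓘(ℝ, E) I (extChartAt I x₀).symm y).inverse
    (mulInvariantVectorField (I := I) (a : GroupLieAlgebra I G) ((extChartAt I x₀).symm y) : E)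

variable [I.Boundaryless]

theorem leftFieldInChart_eq_mpullbackWithin (x₀ : G) (a : E) :
    leftFieldInChart I x₀ a = VectorField.mpullbackWithin 𝓘(ℝ, E) I (extChartAt I x₀).symm
      (mulInvariantVectorField (I := I) (a : GroupLieAlgebra I G)) (Set.range I) := by
  funext y
  rw [VectorField.mpullbackWithin_apply, I.range_eq_univ, mfderivWithin_univ]
  rfl

variable [LieGroup I ∞ G]

theorem modelDeriv_leftFieldInChart {x₀ : G} {y : E} (hy : y ∈ (extChartAt I x₀).target) (a : E) :
    modelDeriv 𝓘(ℝ, E) I (extChartAt I x₀).symm y (leftFieldInChart I x₀ a y) =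
      (mulInvariantVectorField (I := I) (a : GroupLieAlgebra I G)
        ((extChartAt I x₀).symm y) : E) := by
  generalize hw : (mulInvariantVectorField (I := I) (a : GroupLieAlgebra I G)
    ((extChartAt I x₀).symm y) : E) = w
  have h : leftFieldInChart I x₀ a y =
      (modelDeriv 𝓘(ℝ, E) I (extChartAt I x₀).symm y).inverse w := by rw [← hw]; rfl
  rw [h]
  exact ((isInvertible_modelDeriv_extChartAt_symm hy).inverse_apply_eq.1 rfl).symm

theorem leftMC_leftFieldInChart {x₀ : G} {y : E} (hy : y ∈ (extChartAt I x₀).target) (a : E) :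
    coframeInChart I (leftMC I) x₀ y (leftFieldInChart I x₀ a y) = a := by
  rw [coframeInChart_eq, modelDeriv_leftFieldInChart hy]
  exact leftMC_mulInvariantVectorField _ _

theorem leftFieldInChart_leftMC (x : G) (v : E) :
    leftFieldInChart I x (leftMC I x v) (extChartAt I x x) = v := by
  have h := modelDeriv_leftFieldInChart (mem_extChartAt_target (I := I) x) (leftMC I x v)
  rw [modelDeriv_extChartAt_symm_self, extChartAt_to_inv] at h
  exact h.trans (mulInvariantVectorField_leftMC x v)

variable [CompleteSpace E]

theorem differentiableAt_leftFieldInChart (x : G) (a : E) :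
    DifferentiableAt ℝ (leftFieldInChart I x a) (extChartAt I x x) := by
  have : IsManifold I ∞ G := ContMDiffMul.toIsManifold
  have : IsManifold I 2 G := inferInstance
  have h := (mdifferentiableAt_mulInvariantVectorField (I := I)
    (a : GroupLieAlgebra I G) (g := x)).mdifferentiableWithinAt (s := Set.univ)
  have h' := h.differentiableWithinAt_mpullbackWithin_vectorField
  rw [leftFieldInChart_eq_mpullbackWithin]
  refine h'.differentiableAt ?_
  rw [I.range_eq_univ, Set.preimage_univ, Set.univ_inter]
  exact Filter.univ_mem

/-- The bracket of two left-invariant vector fields, computed in a chart. -/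
theorem leftMC_lieBracket_leftFieldInChart (x : G) (a b : E) :
    leftMC I x (VectorField.lieBracket ℝ (leftFieldInChart I x a) (leftFieldInChart I x b)
      (extChartAt I x x)) = brE I G a b := by
  have h := congrFun (mulInvariantVector_mlieBracket (I := I) (a : GroupLieAlgebra I G)
    (b : GroupLieAlgebra I G)) x
  have h1 : leftMC I x (VectorField.mlieBracket I
      (mulInvariantVectorField (I := I) (a : GroupLieAlgebra I G))
      (mulInvariantVectorField (b : GroupLieAlgebra I G)) x) = brE I G a b :=
    (congrArg (fun v : E => leftMC I x v) h).symm.trans (leftMC_mulInvariantVectorField x _)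
  rw [← h1]
  rw [← VectorField.mlieBracketWithin_univ, VectorField.mlieBracketWithin_apply, I.range_eq_univ,
    Set.preimage_univ, Set.univ_inter, ← VectorField.lieBracketWithin_univ]
  have h3 : ∀ w : E, (modelDeriv I 𝓘(ℝ, E) (extChartAt I x) x).inverse w = w := by
    intro w
    rw [modelDeriv_extChartAt_self, ContinuousLinearMap.inverse_id]
    rfl
  refine Eq.trans ?_ (congrArg (leftMC I x) (h3 _).symm)
  rw [leftFieldInChart_eq_mpullbackWithin, leftFieldInChart_eq_mpullbackWithin, I.range_eq_univ]

/-- The structure equation `dθ^l(u, v) = -[θ^l(u), θ^l(v)]`, in the chart at the base point. -/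
theorem fderiv_leftMC_inChart (x : G) (u v : E) :
    fderiv ℝ (coframeInChart I (leftMC I) x) (extChartAt I x x) u v -
      fderiv ℝ (coframeInChart I (leftMC I) x) (extChartAt I x x) v u =
        - brE I G (leftMC I x u) (leftMC I x v) := by
  have hA := differentiableAt_of_contDiffOn_target (contDiffOn_leftMC_inChart (I := I) x)
  -- Differentiate `θ^l(X) = const` for left-invariant `X`.
  have key : ∀ a w, fderiv ℝ (coframeInChart I (leftMC I) x) (extChartAt I x x) w
      (leftFieldInChart I x a (extChartAt I x x)) =
      - leftMC I x (fderiv ℝ (leftFieldInChart I x a) (extChartAt I x x) w) := by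
    intro a w
    have h1 := hA.hasFDerivAt.clm_apply (differentiableAt_leftFieldInChart x a).hasFDerivAt
    have h2 : (fun y => coframeInChart I (leftMC I) x y (leftFieldInChart I x a y)) =ᶠ[
        𝓝 (extChartAt I x x)] fun _ => a := by
      filter_upwards [(isOpen_extChartAt_target (I := I) x).mem_nhds (mem_extChartAt_target x)]
        with y hy using leftMC_leftFieldInChart hy a
    have h3 := h1.unique ((hasFDerivAt_const a _).congr_of_eventuallyEq h2)
    have h4 := congrArg (fun L : E →L[ℝ] E => L w) h3
    simp only [add_apply, ContinuousLinearMap.comp_apply,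
      ContinuousLinearMap.flip_apply, zero_apply, coframeInChart_self] at h4
    rw [eq_neg_iff_add_eq_zero, add_comm]
    exact h4
  have hu := key (leftMC I x u) v
  have hv := key (leftMC I x v) u
  rw [leftFieldInChart_leftMC] at hu hv
  rw [hu, hv, ← leftMC_lieBracket_leftFieldInChart, VectorField.lieBracket,
    leftFieldInChart_leftMC, leftFieldInChart_leftMC, map_sub]
  abel

end MaurerCartan

/-! ### The derivative of the adjoint action -/

section Adjoint

variable {E : Type*} [NormedAddCommGroup E] [NormedSpace ℝ E]
  {H : Type*} [TopologicalSpace H] {I : ModelWithCorners ℝ E H}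
  {G : Type*} [TopologicalSpace G] [ChartedSpace H G] [Group G]

theorem two_le_infty : (1 + 1 : ℕ∞ω) ≤ ∞ := by
  rw [one_add_one_eq_two]
  exact WithTop.coe_le_coe.2 (le_top : (2 : ℕ∞) ≤ ⊤)

theorem modelDeriv_eq_fderiv {E' : Type*} [NormedAddCommGroup E'] [NormedSpace ℝ E']
    (f : E → E') (x : E) : modelDeriv 𝓘(ℝ, E) 𝓘(ℝ, E') f x = fderiv ℝ f x :=
  mfderiv_eq_fderiv

variable (I G) in
/-- The multiplication of `G` in the preferred chart at the unit. -/
def mulInChart (p : E × E) : E :=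
  extChartAt I (1 : G) ((extChartAt I (1 : G)).symm p.1 * (extChartAt I (1 : G)).symm p.2)

variable [LieGroup I ∞ G]

theorem modelDeriv_mul_left_one (g : G) (a : E) :
    modelDeriv I I (fun x => g * x) 1 a =
      modelDeriv I I (fun x => x * g) 1 (adE I g a) := by
  have := modelDeriv_comp (I := I) (I' := I) (I'' := I) (x := (1 : G))
    (f := fun x => g * x * g⁻¹) (g := fun x => x * g) (y := 1) (by group)
    (mdifferentiable_mul_right _ _) (mdifferentiable_conj _ _) a
  rw [adE, ← this]
  congr 2
  funext x
  group

theorem contDiffOn_adE_inChart (x₀ : G) :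
    ContDiffOn ℝ ∞ (fun y => adE I ((extChartAt I x₀).symm y)) (extChartAt I x₀).target := by
  rw [← contMDiffOn_iff_contDiffOn]
  have : IsManifold I ∞ G := ContMDiffMul.toIsManifold
  exact contMDiff_adE.comp_contMDiffOn (contMDiffOn_extChartAt_symm x₀)

theorem mdifferentiable_adE (a : E) : MDifferentiable I 𝓘(ℝ, E) fun x : G => adE I x a :=
  fun x => ((contMDiff_adE x).clm_apply contMDiffAt_const).mdifferentiableAt (n := ∞) (by simp)

/-- Near the unit, multiplication in the chart is multiplication. -/
theorem eventually_symm_mulInChart :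
    ∀ᶠ p in 𝓝 (extChartAt I (1 : G) 1, extChartAt I (1 : G) 1),
      (extChartAt I (1 : G)).symm (mulInChart I G p) =
        (extChartAt I (1 : G)).symm p.1 * (extChartAt I (1 : G)).symm p.2 := by
  have hφ : ContinuousAt (extChartAt I (1 : G)).symm (extChartAt I (1 : G) 1) :=
    continuousAt_extChartAt_symm 1
  have : ContinuousMul G := continuousMul_of_contMDiffMul I ∞
  have h1 : ContinuousAt
      (fun p : E × E => (extChartAt I (1 : G)).symm p.1 * (extChartAt I (1 : G)).symm p.2)
      (extChartAt I (1 : G) 1, extChartAt I (1 : G) 1) :=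
    (hφ.comp (x := (extChartAt I (1 : G) 1, extChartAt I (1 : G) 1)) continuousAt_fst).mul
      (hφ.comp (x := (extChartAt I (1 : G) 1, extChartAt I (1 : G) 1)) continuousAt_snd)
  have h2 : (extChartAt I (1 : G)).source ∈ 𝓝
      ((extChartAt I (1 : G)).symm (extChartAt I (1 : G) 1) *
        (extChartAt I (1 : G)).symm (extChartAt I (1 : G) 1)) := by
    rw [extChartAt_to_inv, mul_one]
    exact extChartAt_source_mem_nhds 1
  filter_upwards [h1.preimage_mem_nhds h2] with p hp using (extChartAt I (1 : G)).left_inv hp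

variable [I.Boundaryless]

theorem contDiffAt_mulInChart :
    ContDiffAt ℝ ∞ (mulInChart I G) (extChartAt I (1 : G) 1, extChartAt I (1 : G) 1) := by
  have : IsManifold I ∞ G := ContMDiffMul.toIsManifold
  have hφ : ContMDiffAt 𝓘(ℝ, E) I ∞ (extChartAt I (1 : G)).symm (extChartAt I (1 : G) 1) :=
    ((contMDiffOn_extChartAt_symm (1 : G)) _ (mem_extChartAt_target 1)).contMDiffAt
      (extChartAt_target_mem_nhds 1)
  have h1 : ContMDiffAt (𝓘(ℝ, E).prod 𝓘(ℝ, E)) I ∞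
      (fun p : E × E => (extChartAt I (1 : G)).symm p.1 * (extChartAt I (1 : G)).symm p.2)
      (extChartAt I (1 : G) 1, extChartAt I (1 : G) 1) :=
    ContMDiffAt.mul (hφ.comp (extChartAt I (1 : G) 1, extChartAt I (1 : G) 1) contMDiffAt_fst)
      (hφ.comp (extChartAt I (1 : G) 1, extChartAt I (1 : G) 1) contMDiffAt_snd)
  have h2 : ContMDiffAt I 𝓘(ℝ, E) ∞ (extChartAt I (1 : G))
      ((extChartAt I (1 : G)).symm (extChartAt I (1 : G) 1) *
        (extChartAt I (1 : G)).symm (extChartAt I (1 : G) 1)) := by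
    rw [extChartAt_to_inv, mul_one]
    exact contMDiffAt_extChartAt
  have h3 := ContMDiffAt.comp (extChartAt I (1 : G) 1, extChartAt I (1 : G) 1) h2 h1
  rw [← modelWithCornersSelf_prod, chartedSpaceSelf_prod] at h3
  exact h3.contDiffAt

/-- In the chart at the unit, the left-invariant vector fields are the derivatives of the
multiplication in the second variable at the unit. -/
theorem modelDeriv_mul_left_of_eventually {y : E} (hy : y ∈ (extChartAt I (1 : G)).target)
    (h : ∀ᶠ p in 𝓝 (y, extChartAt I (1 : G) 1),
      (extChartAt I (1 : G)).symm (mulInChart I G p) =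
        (extChartAt I (1 : G)).symm p.1 * (extChartAt I (1 : G)).symm p.2)
    (hd : DifferentiableAt ℝ (mulInChart I G) (y, extChartAt I (1 : G) 1)) (a : E) :
    modelDeriv 𝓘(ℝ, E) I (extChartAt I (1 : G)).symm y
      (fderiv ℝ (mulInChart I G) (y, extChartAt I (1 : G) 1) (0, a)) =
      modelDeriv I I (fun x => (extChartAt I (1 : G)).symm y * x) 1 a := by
  set o := extChartAt I (1 : G) 1 with ho
  have hyo : mulInChart I G (y, o) = y := by
    rw [mulInChart, ho, extChartAt_to_inv, mul_one]
    exact (extChartAt I (1 : G)).right_inv hy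
  have hpair : HasFDerivAt (fun z : E => (y, z)) (ContinuousLinearMap.inr ℝ E E) o :=
    hasFDerivAt_prodMk_right y o
  have hd' : HasFDerivAt (fun z => mulInChart I G (y, z)) _ o :=
    HasFDerivAt.comp o (f := fun z => (y, z)) hd.hasFDerivAt hpair
  have h1 := modelDeriv_comp (I := 𝓘(ℝ, E)) (I' := 𝓘(ℝ, E)) (I'' := I) (x := o)
    (f := fun z => mulInChart I G (y, z)) (g := (extChartAt I (1 : G)).symm) hyo
    (mdifferentiableAt_extChartAt_symm hy) hd'.differentiableAt.mdifferentiableAt a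
  rw [modelDeriv_eq_fderiv, hd'.fderiv] at h1
  refine h1.symm.trans ?_
  have he : (fun z => (extChartAt I (1 : G)).symm (mulInChart I G (y, z))) =ᶠ[𝓝 o]
      fun z => (extChartAt I (1 : G)).symm y * (extChartAt I (1 : G)).symm z :=
    (hpair.continuousAt.tendsto.eventually h)
  have h2 := modelDeriv_comp (I := 𝓘(ℝ, E)) (I' := I) (I'' := I) (x := o)
    (f := (extChartAt I (1 : G)).symm) (g := fun x => (extChartAt I (1 : G)).symm y * x)
    (extChartAt_to_inv 1) (mdifferentiable_mul_left _ _)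
    (mdifferentiableAt_extChartAt_symm (mem_extChartAt_target 1)) a
  rw [modelDeriv_extChartAt_symm_self] at h2
  refine Eq.trans ?_ h2
  have := he.mfderiv_eq (I := 𝓘(ℝ, E)) (I' := I)
  exact congrArg (fun L : E →L[ℝ] E => L a) this

/-- In the chart at the unit, the right-invariant vector fields are the derivatives of the
multiplication in the first variable at the unit. -/
theorem modelDeriv_mul_right_of_eventually {y : E} (hy : y ∈ (extChartAt I (1 : G)).target)
    (h : ∀ᶠ p in 𝓝 (extChartAt I (1 : G) 1, y),
      (extChartAt I (1 : G)).symm (mulInChart I G p) =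
        (extChartAt I (1 : G)).symm p.1 * (extChartAt I (1 : G)).symm p.2)
    (hd : DifferentiableAt ℝ (mulInChart I G) (extChartAt I (1 : G) 1, y)) (a : E) :
    modelDeriv 𝓘(ℝ, E) I (extChartAt I (1 : G)).symm y
      (fderiv ℝ (mulInChart I G) (extChartAt I (1 : G) 1, y) (a, 0)) =
      modelDeriv I I (fun x => x * (extChartAt I (1 : G)).symm y) 1 a := by
  set o := extChartAt I (1 : G) 1 with ho
  have hyo : mulInChart I G (o, y) = y := by
    rw [mulInChart, ho, extChartAt_to_inv, one_mul]
    exact (extChartAt I (1 : G)).right_inv hy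
  have hpair : HasFDerivAt (fun z : E => (z, y)) (ContinuousLinearMap.inl ℝ E E) o :=
    hasFDerivAt_prodMk_left o y
  have hd' : HasFDerivAt (fun z => mulInChart I G (z, y)) _ o :=
    HasFDerivAt.comp o (f := fun z => (z, y)) hd.hasFDerivAt hpair
  have h1 := modelDeriv_comp (I := 𝓘(ℝ, E)) (I' := 𝓘(ℝ, E)) (I'' := I) (x := o)
    (f := fun z => mulInChart I G (z, y)) (g := (extChartAt I (1 : G)).symm) hyo
    (mdifferentiableAt_extChartAt_symm hy) hd'.differentiableAt.mdifferentiableAt a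
  rw [modelDeriv_eq_fderiv, hd'.fderiv] at h1
  refine h1.symm.trans ?_
  have he : (fun z => (extChartAt I (1 : G)).symm (mulInChart I G (z, y))) =ᶠ[𝓝 o]
      fun z => (extChartAt I (1 : G)).symm z * (extChartAt I (1 : G)).symm y :=
    (hpair.continuousAt.tendsto.eventually h)
  have h2 := modelDeriv_comp (I := 𝓘(ℝ, E)) (I' := I) (I'' := I) (x := o)
    (f := (extChartAt I (1 : G)).symm) (g := fun x => x * (extChartAt I (1 : G)).symm y)
    (extChartAt_to_inv 1) (mdifferentiable_mul_right _ _)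
    (mdifferentiableAt_extChartAt_symm (mem_extChartAt_target 1)) a
  rw [modelDeriv_extChartAt_symm_self] at h2
  refine Eq.trans ?_ h2
  have := he.mfderiv_eq (I := 𝓘(ℝ, E)) (I' := I)
  exact congrArg (fun L : E →L[ℝ] E => L a) this

variable [CompleteSpace E]

/-- The derivative of the adjoint action at the unit is the bracket. In the chart `φ` at the unit,
with multiplication `m`, left- and right-invariant fields are `∂₂m` and `∂₁m`, and they differ by
the adjoint action. Hence the derivative of `Ad` is the difference of two mixed second derivatives
of `m`; by their symmetry this is the bracket of left-invariant fields. -/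
theorem modelDeriv_adE_one (v a : E) :
    modelDeriv I 𝓘(ℝ, E) (fun x : G => adE I x a) 1 v = brE I G v a := by
  set φ := extChartAt I (1 : G) with hφ
  set o := φ 1 with ho
  set m := mulInChart I G with hm
  have hφo : φ.symm o = 1 := extChartAt_to_inv 1
  have hot : o ∈ φ.target := mem_extChartAt_target 1
  have hms : ContDiffAt ℝ ∞ m (o, o) := contDiffAt_mulInChart
  have hD : DifferentiableAt ℝ (fderiv ℝ m) (o, o) :=
    (hms.fderiv_right (m := 1) two_le_infty).differentiableAt (by simp)
  have htgt : ∀ᶠ y in 𝓝 o, y ∈ φ.target := extChartAt_target_mem_nhds 1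
  have hdiff : ∀ᶠ p in 𝓝 (o, o), DifferentiableAt ℝ m p :=
    ((hms.of_le (m := 1) (by simp)).eventually (by simp)).mono
      fun p hp => hp.differentiableAt (by simp)
  have hsym := (eventually_symm_mulInChart (I := I) (G := G)).eventually_nhds
  have hinl : HasFDerivAt (fun z : E => (z, o)) (ContinuousLinearMap.inl ℝ E E) o :=
    hasFDerivAt_prodMk_left o o
  have hinr : HasFDerivAt (fun z : E => (o, z)) (ContinuousLinearMap.inr ℝ E E) o :=
    hasFDerivAt_prodMk_right o o
  have hL : ∀ᶠ y in 𝓝 o, ∀ b, modelDeriv 𝓘(ℝ, E) I φ.symm y (fderiv ℝ m (y, o) (0, b)) =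
      modelDeriv I I (fun x => φ.symm y * x) 1 b := by
    filter_upwards [htgt, hinl.continuousAt.tendsto.eventually hsym,
      hinl.continuousAt.tendsto.eventually hdiff] with y h1 h2 h3 b
    exact modelDeriv_mul_left_of_eventually h1 h2 h3 b
  have hR : ∀ᶠ y in 𝓝 o, ∀ b, modelDeriv 𝓘(ℝ, E) I φ.symm y (fderiv ℝ m (o, y) (b, 0)) =
      modelDeriv I I (fun x => x * φ.symm y) 1 b := by
    filter_upwards [htgt, hinr.continuousAt.tendsto.eventually hsym,
      hinr.continuousAt.tendsto.eventually hdiff] with y h1 h2 h3 b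
    exact modelDeriv_mul_right_of_eventually h1 h2 h3 b
  -- Left-invariant fields in the chart.
  have hX : ∀ b, leftFieldInChart I (1 : G) b =ᶠ[𝓝 o] fun y => fderiv ℝ m (y, o) (0, b) := by
    intro b
    filter_upwards [htgt, hL] with y h1 h2
    obtain ⟨e, he⟩ := isInvertible_modelDeriv_extChartAt_symm h1
    have h3 := (modelDeriv_leftFieldInChart h1 b).trans (h2 b).symm
    rw [← he] at h3
    exact e.injective h3
  have hXZ : (fun y => fderiv ℝ m (y, o) (0, a)) =ᶠ[𝓝 o]
      fun y => fderiv ℝ m (o, y) (adE I (φ.symm y) a, 0) := by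
    filter_upwards [htgt, hL, hR] with y h1 h2 h3
    obtain ⟨e, he⟩ := isInvertible_modelDeriv_extChartAt_symm h1
    have h4 := (h2 a).trans ((modelDeriv_mul_left_one _ a).trans (h3 _).symm)
    rw [← he] at h4
    exact e.injective h4
  have hX' : ∀ b, HasFDerivAt (leftFieldInChart I (1 : G) b)
      (((fderiv ℝ (fderiv ℝ m) (o, o)).comp (ContinuousLinearMap.inl ℝ E E)).flip (0, b)) o := by
    intro b
    refine HasFDerivAt.congr_of_eventuallyEq ?_ (hX b)
    have h1 : HasFDerivAt (fun y => fderiv ℝ m (y, o)) _ o :=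
      HasFDerivAt.comp o (f := fun y => (y, o)) hD.hasFDerivAt hinl
    simpa using h1.clm_apply (hasFDerivAt_const ((0 : E), b) o)
  have hX0 : ∀ b, leftFieldInChart I (1 : G) b o = b := by
    intro b
    have := leftFieldInChart_leftMC (I := I) (1 : G) b
    rwa [leftMC_one] at this
  have hP : DifferentiableAt ℝ (fun y => adE I (φ.symm y) a) o :=
    ((contDiffOn_adE_inChart (I := I) (1 : G)).contDiffAt
      (extChartAt_target_mem_nhds 1)).differentiableAt (by simp) |>.clm_apply
        (differentiableAt_const a)
  have hP0 : adE I (φ.symm o) a = a := by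
    rw [hφo, adE_one]
    rfl
  have hZ0 : ∀ b, fderiv ℝ m (o, o) (b, 0) = b := by
    intro b
    have h1 := hR.self_of_nhds b
    have h2 : (fun x : G => x * 1) = fun x => x := by funext x; simp
    rw [ho, modelDeriv_extChartAt_symm_self, extChartAt_to_inv, h2, modelDeriv_id] at h1
    exact h1
  -- Differentiate `hXZ` at `o`.
  have hmain : fderiv ℝ (fderiv ℝ m) (o, o) (v, 0) (0, a) =
      fderiv ℝ (fderiv ℝ m) (o, o) (0, v) (a, 0) + fderiv ℝ (fun y => adE I (φ.symm y) a) o v := by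
    have h1 : HasFDerivAt (fun y => fderiv ℝ m (o, y)) _ o :=
      HasFDerivAt.comp o (f := fun y => (o, y)) hD.hasFDerivAt hinr
    have h2 : HasFDerivAt (fun y => (adE I (φ.symm y) a, (0 : E))) _ o :=
      hP.hasFDerivAt.prodMk (hasFDerivAt_const (0 : E) o)
    have h3 := (h1.clm_apply h2).congr_of_eventuallyEq hXZ
    have h4 := ((hX' a).congr_of_eventuallyEq (hX a).symm).unique h3
    have h5 := congrArg (fun L : E →L[ℝ] E => L v) h4
    simp only [ContinuousLinearMap.flip_apply, ContinuousLinearMap.comp_apply, add_apply,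
      ContinuousLinearMap.inl_apply, ContinuousLinearMap.inr_apply, ContinuousLinearMap.prod_apply,
      zero_apply, hP0, hZ0] at h5
    rw [h5, add_comm]
  have hsymm := hms.isSymmSndFDerivAt (by simpa [one_add_one_eq_two] using two_le_infty) (0, v)
    (a, 0)
  have hbr : brE I G v a = VectorField.lieBracket ℝ (leftFieldInChart I (1 : G) v)
      (leftFieldInChart I (1 : G) a) o := by
    have := leftMC_lieBracket_leftFieldInChart (I := I) (1 : G) v a
    rw [leftMC_one] at this
    exact this.symm
  rw [hbr, VectorField.lieBracket, (hX' a).fderiv, (hX' v).fderiv, hX0, hX0]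
  simp only [ContinuousLinearMap.flip_apply, ContinuousLinearMap.comp_apply,
    ContinuousLinearMap.inl_apply]
  rw [hmain, ← hsymm, add_sub_cancel_left]
  have hc := modelDeriv_comp (I := 𝓘(ℝ, E)) (I' := I) (I'' := 𝓘(ℝ, E)) (x := o)
    (f := φ.symm) (g := fun x : G => adE I x a) hφo (mdifferentiable_adE a 1)
    (mdifferentiableAt_extChartAt_symm hot) v
  rw [modelDeriv_eq_fderiv, ho, modelDeriv_extChartAt_symm_self] at hc
  exact hc.symm

theorem modelDeriv_adE (g : G) (w a : E) :
    modelDeriv I 𝓘(ℝ, E) (fun x : G => adE I x a) g w = brE I G (rightMC I g w) (adE I g a) := by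
  have h := modelDeriv_comp (I := I) (I' := I) (I'' := 𝓘(ℝ, E)) (x := g) (f := fun x => x * g⁻¹)
    (g := fun x : G => adE I x (adE I g a)) (mul_inv_cancel g) (mdifferentiable_adE _ _)
    (mdifferentiable_mul_right _ _) w
  have he : (fun x : G => adE I (x * g⁻¹) (adE I g a)) = fun x => adE I x a := by
    funext x
    rw [← adE_mul, inv_mul_cancel_right]
  rw [he, modelDeriv_adE_one] at h
  exact h

/-- The adjoint action is by automorphisms of the Lie algebra: differentiate
`Ad_{g x g⁻¹} = Ad_g Ad_x Ad_g⁻¹` at `x = 1`. -/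
theorem adE_brE (g : G) (v a : E) :
    adE I g (brE I G v a) = brE I G (adE I g v) (adE I g a) := by
  have h1 := modelDeriv_comp (I := I) (I' := I) (I'' := 𝓘(ℝ, E)) (x := (1 : G))
    (f := fun x => g * x * g⁻¹) (y := 1)
    (g := fun x : G => adE I x (adE I g a)) (by group) (mdifferentiable_adE _ _)
    (mdifferentiable_conj _ _) v
  have h2 := modelDeriv_comp (I := I) (I' := 𝓘(ℝ, E)) (I'' := 𝓘(ℝ, E)) (x := (1 : G))
    (f := fun x : G => adE I x a) (g := adE I g) rfl
    (adE I g).differentiableAt.mdifferentiableAt (mdifferentiable_adE _ _) v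
  have he : (fun x : G => adE I (g * x * g⁻¹) (adE I g a)) = fun x => adE I g (adE I x a) := by
    funext x
    rw [← adE_mul, inv_mul_cancel_right, adE_mul]
  rw [modelDeriv_adE_one, he, h2, modelDeriv_adE_one, modelDeriv_eq_fderiv,
    ContinuousLinearMap.fderiv] at h1
  exact h1

/-- `Ad` in a chart is differentiable, with derivative `u ↦ [θ^r(u), Ad ·]`. -/
theorem fderiv_adE_inChart {x₀ : G} {y : E} (hy : y ∈ (extChartAt I x₀).target) (a u : E) :
    HasFDerivAt (fun y => adE I ((extChartAt I x₀).symm y) a)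
      (fderiv ℝ (fun y => adE I ((extChartAt I x₀).symm y) a) y) y ∧
    fderiv ℝ (fun y => adE I ((extChartAt I x₀).symm y) a) y u =
      brE I G (coframeInChart I (rightMC I) x₀ y u) (adE I ((extChartAt I x₀).symm y) a) := by
  constructor
  · exact (((contDiffOn_adE_inChart (I := I) x₀).contDiffAt
      ((isOpen_extChartAt_target x₀).mem_nhds hy)).differentiableAt (by simp) |>.clm_apply
        (differentiableAt_const a)).hasFDerivAt
  · have hc := modelDeriv_comp (I := 𝓘(ℝ, E)) (I' := I) (I'' := 𝓘(ℝ, E)) (x := y)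
      (f := (extChartAt I x₀).symm) (g := fun x : G => adE I x a) rfl (mdifferentiable_adE a _)
      (mdifferentiableAt_extChartAt_symm hy) u
    rw [modelDeriv_eq_fderiv, modelDeriv_adE] at hc
    rw [hc, coframeInChart_eq]

end Adjoint

/-! ### Invariant bilinear forms and the right Maurer-Cartan equation -/

section InvariantForm

variable {E : Type*} [NormedAddCommGroup E] [NormedSpace ℝ E]
  {H : Type*} [TopologicalSpace H] {I : ModelWithCorners ℝ E H}
  {G : Type*} [TopologicalSpace G] [ChartedSpace H G] [Group G]

/-- A bilinear form on the Lie algebra, read in the model space. -/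
def formE (B : LinearMap.BilinForm ℝ (GroupLieAlgebra I G)) : E →ₗ[ℝ] E →ₗ[ℝ] ℝ := B

theorem adInvariant_iff_formE {B : LinearMap.BilinForm ℝ (GroupLieAlgebra I G)} :
    AdInvariant B ↔ ∀ (g : G) (a b : E), formE B (adE I g a) (adE I g b) = formE B a b :=
  Iff.rfl

variable [CompleteSpace E] [LieGroup I ∞ G]

theorem formE_invariant {B : LinearMap.BilinForm ℝ (GroupLieAlgebra I G)} (hB : IsQuadratic B)
    (a b c : E) : formE B (brE I G a b) c + formE B b (brE I G a c) = 0 :=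
  hB.invariant a b c

theorem formE_symm {B : LinearMap.BilinForm ℝ (GroupLieAlgebra I G)} (hB : IsQuadratic B)
    (a b : E) : formE B a b = formE B b a :=
  hB.symm a b

theorem brE_skew (a b : E) : brE I G a b = - brE I G b a :=
  (show ∀ a b : GroupLieAlgebra I G, (⁅a, b⁆ : GroupLieAlgebra I G) = -⁅b, a⁆ from
    fun a b => (lie_skew a b).symm) a b

end InvariantForm

section RightMaurerCartan

variable {E : Type*} [NormedAddCommGroup E] [NormedSpace ℝ E] [CompleteSpace E]
  {H : Type*} [TopologicalSpace H] {I : ModelWithCorners ℝ E H} [I.Boundaryless]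
  {G : Type*} [TopologicalSpace G] [ChartedSpace H G] [Group G] [LieGroup I ∞ G]

/-- The structure equation `dθ^r(u, v) = [θ^r(u), θ^r(v)]`, in the chart at the base point. It comes
from the one for `θ^l` by differentiating `θ^r = Ad θ^l`. -/
theorem fderiv_rightMC_inChart (x : G) (u v : E) :
    fderiv ℝ (coframeInChart I (rightMC I) x) (extChartAt I x x) u v -
      fderiv ℝ (coframeInChart I (rightMC I) x) (extChartAt I x x) v u =
        brE I G (rightMC I x u) (rightMC I x v) := by
  have hA := differentiableAt_of_contDiffOn_target (contDiffOn_leftMC_inChart (I := I) x)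
  have hP := differentiableAt_of_contDiffOn_target (contDiffOn_adE_inChart (I := I) x)
  have hC : coframeInChart I (rightMC I) x = fun y =>
      (adE I ((extChartAt I x).symm y)).comp (coframeInChart I (leftMC I) x y) := by
    funext y
    ext v
    exact rightMC_eq _ _
  have hPb : ∀ w b, fderiv ℝ (fun y => adE I ((extChartAt I x).symm y)) (extChartAt I x x) w b =
      brE I G (rightMC I x w) (adE I x b) := by
    intro w b
    have h1 := hP.hasFDerivAt.clm_apply (hasFDerivAt_const b (extChartAt I x x))
    have h2 := (fderiv_adE_inChart (I := I) (mem_extChartAt_target x) b w).2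
    rw [h1.fderiv, coframeInChart_self, extChartAt_to_inv] at h2
    simpa using h2
  have key : ∀ w b, fderiv ℝ (coframeInChart I (rightMC I) x) (extChartAt I x x) w b =
      brE I G (rightMC I x w) (rightMC I x b) +
        adE I x (fderiv ℝ (coframeInChart I (leftMC I) x) (extChartAt I x x) w b) := by
    intro w b
    rw [hC, (hP.hasFDerivAt.clm_comp hA.hasFDerivAt).fderiv]
    simp only [add_apply, ContinuousLinearMap.comp_apply, ContinuousLinearMap.compL_apply,
      ContinuousLinearMap.flip_apply, hPb, coframeInChart_self, extChartAt_to_inv]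
    rw [add_comm, rightMC_eq x b]
  have hl := congrArg (adE I x) (fderiv_leftMC_inChart (I := I) x u v)
  rw [map_sub, map_neg, adE_brE, ← rightMC_eq, ← rightMC_eq] at hl
  rw [key, key, brE_skew (rightMC I x v) (rightMC I x u), sub_eq_iff_eq_add]
  rw [sub_eq_iff_eq_add] at hl
  rw [hl]

variable [FiniteDimensional ℝ E]

/-- For an `ad`-invariant form, `g ↦ ⟨Ad_g a, Ad_g b⟩` is locally constant, since its derivative
along `w` is `⟨[θ^r(w), Ad_g a], Ad_g b⟩ + ⟨Ad_g a, [θ^r(w), Ad_g b]⟩`. -/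
theorem isLocallyConstant_formE_adE {B : LinearMap.BilinForm ℝ (GroupLieAlgebra I G)}
    (hB : IsQuadratic B) (a b : E) :
    IsLocallyConstant fun g : G => formE B (adE I g a) (adE I g b) := by
  rw [IsLocallyConstant.iff_eventually_eq]
  intro x
  let Bc : E →L[ℝ] E →L[ℝ] ℝ :=
    (LinearMap.toContinuousLinearMap.toLinearMap ∘ₗ formE B).toContinuousLinearMap
  have hder : ∀ y ∈ (extChartAt I x).target, HasFDerivAt
      (fun y => formE B (adE I ((extChartAt I x).symm y) a) (adE I ((extChartAt I x).symm y) b))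
      (0 : E →L[ℝ] ℝ) y := by
    intro y hy
    have ha := (fderiv_adE_inChart (I := I) hy a 0).1
    have hb := (fderiv_adE_inChart (I := I) hy b 0).1
    have h := Bc.hasFDerivAt_of_bilinear ha hb
    refine HasFDerivAt.congr_fderiv (f := fun y => Bc (adE I ((extChartAt I x).symm y) a)
      (adE I ((extChartAt I x).symm y) b)) h ?_
    ext u
    have hu := formE_invariant hB (coframeInChart I (rightMC I) x y u)
      (adE I ((extChartAt I x).symm y) a) (adE I ((extChartAt I x).symm y) b)
    rw [← (fderiv_adE_inChart (I := I) hy a u).2, ← (fderiv_adE_inChart (I := I) hy b u).2,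
      add_comm] at hu
    exact hu
  obtain ⟨r, hr, hball⟩ := Metric.isOpen_iff.1 (isOpen_extChartAt_target (I := I) x) _
    (mem_extChartAt_target x)
  have hconst : ∀ y ∈ Metric.ball (extChartAt I x x) r,
      formE B (adE I ((extChartAt I x).symm y) a) (adE I ((extChartAt I x).symm y) b) =
      formE B (adE I ((extChartAt I x).symm (extChartAt I x x)) a)
        (adE I ((extChartAt I x).symm (extChartAt I x x)) b) := by
    intro y hy
    refine (Metric.isOpen_ball.is_const_of_fderiv_eq_zero (convex_ball _ r).isPreconnected
      (𝕜 := ℝ) (f := fun y => formE B (adE I ((extChartAt I x).symm y) a)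
        (adE I ((extChartAt I x).symm y) b))
      (fun z hz => (hder z (hball hz)).differentiableAt.differentiableWithinAt)
      (fun z hz => (hder z (hball hz)).fderiv) (Metric.mem_ball_self hr) hy).symm
  filter_upwards [extChartAt_source_mem_nhds (I := I) x,
    (continuousAt_extChartAt (I := I) x).preimage_mem_nhds (Metric.ball_mem_nhds _ hr)]
    with z hz hz'
  have := hconst _ hz'
  rwa [(extChartAt I x).left_inv hz, extChartAt_to_inv] at this

theorem adInvariant_of_preconnectedSpace [PreconnectedSpace G]
    {B : LinearMap.BilinForm ℝ (GroupLieAlgebra I G)} (hB : IsQuadratic B) : AdInvariant B := by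
  rw [adInvariant_iff_formE]
  intro g a b
  have := (isLocallyConstant_formE_adE hB a b).apply_eq_of_preconnectedSpace g 1
  simpa only [adE_one, ContinuousLinearMap.id_apply] using this

end RightMaurerCartan

/-! ### Product coframes on powers of a manifold -/

section ProductCoframe

variable {E : Type*} [NormedAddCommGroup E] [NormedSpace ℝ E]
  {H : Type*} [TopologicalSpace H] {I : ModelWithCorners ℝ E H} {M : Type*} {p : ℕ}

/-- The coframe on `M^p` whose `i`-th component is the pullback of the `1`-form `θ i` along the
`i`-th projection. -/
def productCoframe (θ : Fin p → M → E →L[ℝ] E) (g : Nerve M p) :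
    (Fin p → E) →L[ℝ] (Fin p → E) :=
  ContinuousLinearMap.pi fun i => (θ i (g i)).comp (ContinuousLinearMap.proj i)

theorem productCoframe_apply (θ : Fin p → M → E →L[ℝ] E) (g : Nerve M p) (v : Fin p → E)
    (i : Fin p) : productCoframe θ g v i = θ i (g i) (v i) := rfl

variable [TopologicalSpace M] [ChartedSpace H M]

theorem modelDeriv_nerve {E' : Type*} [NormedAddCommGroup E'] [NormedSpace ℝ E']
    {H' : Type*} [TopologicalSpace H'] {J : ModelWithCorners ℝ E' H'}
    {N : Type*} [TopologicalSpace N] [ChartedSpace H' N] {f : N → Nerve M p} {x : N}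
    (h : ∀ i, MDifferentiableAt J I (fun y => f y i) x) (v : E') (i : Fin p) :
    modelDeriv J (nerveModel I p) f x v i = modelDeriv J I (fun y => f y i) x v :=
  mfderiv_nerve_apply h v i

theorem modelDeriv_nerve_eval (g : Nerve M p) (i : Fin p) (v : Fin p → E) :
    modelDeriv (nerveModel I p) I (fun y : Nerve M p => y i) g v = v i := by
  rw [modelDeriv, (hasMFDerivAt_nerve_apply g i).mfderiv]
  rfl

theorem mdifferentiableAt_nerve_eval (g : Nerve M p) (i : Fin p) :
    MDifferentiableAt (nerveModel I p) I (fun y : Nerve M p => y i) g :=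
  (hasMFDerivAt_nerve_apply g i).mdifferentiableAt

variable [IsManifold I 1 M] [I.Boundaryless]

theorem coframeInChart_productCoframe {θ : Fin p → M → E →L[ℝ] E} {x : Nerve M p} {y : Fin p → E}
    (hy : y ∈ (extChartAt (nerveModel I p) x).target) (v : Fin p → E) (i : Fin p) :
    coframeInChart (nerveModel I p) (productCoframe θ) x y v i =
      coframeInChart I (θ i) (x i) (y i) (v i) := by
  rw [extChartAt_nerve_target] at hy
  have hd : ∀ i, MDifferentiableAt 𝓘(ℝ, Fin p → E) I
      (fun y : Fin p → E => (extChartAt (nerveModel I p) x).symm y i) y := fun i =>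
    MDifferentiableAt.comp y (g := (extChartAt I (x i)).symm) (f := fun y : Fin p → E => y i)
      (mdifferentiableAt_extChartAt_symm (hy i (Set.mem_univ i)))
      (ContinuousLinearMap.proj (R := ℝ) (φ := fun _ : Fin p => E)
        i).differentiableAt.mdifferentiableAt
  have hc := modelDeriv_comp (I := 𝓘(ℝ, Fin p → E)) (I' := 𝓘(ℝ, E)) (I'' := I) (x := y)
    (f := fun y => y i) (g := (extChartAt I (x i)).symm) rfl
    (mdifferentiableAt_extChartAt_symm (hy i (Set.mem_univ i)))
    (ContinuousLinearMap.proj (R := ℝ) (φ := fun _ : Fin p => E)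
        i).differentiableAt.mdifferentiableAt v
  have hproj : modelDeriv 𝓘(ℝ, Fin p → E) 𝓘(ℝ, E) (fun y : Fin p → E => y i) y v = v i := by
    rw [modelDeriv_eq_fderiv]
    have := (ContinuousLinearMap.proj (R := ℝ) (φ := fun _ : Fin p => E) i).fderiv (x := y)
    exact congrArg (fun L : (Fin p → E) →L[ℝ] E => L v) this
  rw [hproj] at hc
  rw [coframeInChart_eq, productCoframe_apply, modelDeriv_nerve hd, coframeInChart_eq]
  exact congrArg _ hc

variable [FiniteDimensional ℝ E]

theorem contDiffOn_productCoframe_inChart {θ : Fin p → M → E →L[ℝ] E}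
    (hθ : ∀ i x, ContDiffOn ℝ ∞ (coframeInChart I (θ i) x) (extChartAt I x).target)
    (x : Nerve M p) :
    ContDiffOn ℝ ∞ (coframeInChart (nerveModel I p) (productCoframe θ) x)
      (extChartAt (nerveModel I p) x).target := by
  rw [contDiffOn_clm_apply]
  intro v
  rw [contDiffOn_pi]
  intro i
  have h : ContDiffOn ℝ ∞ (fun y : Fin p → E => coframeInChart I (θ i) (x i) (y i) (v i))
      (extChartAt (nerveModel I p) x).target := by
    refine ContDiffOn.clm_apply ((hθ i (x i)).comp (contDiff_apply ℝ E i).contDiffOn ?_)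
      contDiffOn_const
    intro y hy
    rw [extChartAt_nerve_target] at hy
    exact hy i (Set.mem_univ i)
  exact h.congr fun y hy => coframeInChart_productCoframe hy v i

/-- A structure equation for each factor gives the componentwise structure equation for the product
coframe. -/
theorem fderiv_productCoframe_inChart {θ : Fin p → M → E →L[ℝ] E}
    (hθ : ∀ i x, ContDiffOn ℝ ∞ (coframeInChart I (θ i) x) (extChartAt I x).target)
    {K : Fin p → E → E → E} {x : Nerve M p}
    (hK : ∀ i u v, fderiv ℝ (coframeInChart I (θ i) (x i)) (extChartAt I (x i) (x i)) u v -
      fderiv ℝ (coframeInChart I (θ i) (x i)) (extChartAt I (x i) (x i)) v u =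
        K i (θ i (x i) u) (θ i (x i) v)) (u v : Fin p → E) :
    fderiv ℝ (coframeInChart (nerveModel I p) (productCoframe θ) x)
        (extChartAt (nerveModel I p) x x) u v -
      fderiv ℝ (coframeInChart (nerveModel I p) (productCoframe θ) x)
        (extChartAt (nerveModel I p) x x) v u =
      fun i => K i (coframeInChart (nerveModel I p) (productCoframe θ) x
          (extChartAt (nerveModel I p) x x) u i)
        (coframeInChart (nerveModel I p) (productCoframe θ) x
          (extChartAt (nerveModel I p) x x) v i) := by
  have hT := differentiableAt_of_contDiffOn_target (contDiffOn_productCoframe_inChart hθ x)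
  have key : ∀ (w b : Fin p → E) (i : Fin p),
      fderiv ℝ (coframeInChart (nerveModel I p) (productCoframe θ) x)
        (extChartAt (nerveModel I p) x x) w b i =
      fderiv ℝ (coframeInChart I (θ i) (x i)) (extChartAt I (x i) (x i)) (w i) (b i) := by
    intro w b i
    have h1 := hasFDerivAt_pi'.1
      (hT.hasFDerivAt.clm_apply (hasFDerivAt_const b (extChartAt (nerveModel I p) x x))) i
    have h2 : HasFDerivAt (fun y : Fin p → E => coframeInChart I (θ i) (x i) (y i)) _
        (extChartAt (nerveModel I p) x x) :=
      HasFDerivAt.comp (extChartAt (nerveModel I p) x x) (f := fun y : Fin p → E => y i)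
        (differentiableAt_of_contDiffOn_target (hθ i (x i))).hasFDerivAt
        (ContinuousLinearMap.proj (R := ℝ) (φ := fun _ : Fin p => E) i).hasFDerivAt
    have h3 := h2.clm_apply (hasFDerivAt_const (b i) (extChartAt (nerveModel I p) x x))
    have he : (fun y => coframeInChart (nerveModel I p) (productCoframe θ) x y b i) =ᶠ[
        𝓝 (extChartAt (nerveModel I p) x x)]
        fun y => coframeInChart I (θ i) (x i) (y i) (b i) := by
      filter_upwards [extChartAt_target_mem_nhds (I := nerveModel I p) x] with y hy
      exact coframeInChart_productCoframe hy b i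
    have h4 := congrArg (fun L : (Fin p → E) →L[ℝ] E => L w)
      (h1.unique (h3.congr_of_eventuallyEq he))
    simpa using h4
  funext i
  rw [Pi.sub_apply, key, key, hK, coframeInChart_self, coframeInChart_self]
  rfl

end ProductCoframe

/-! ### Evaluation of the forms on the nerve -/

section Evaluation

variable {E : Type*} [NormedAddCommGroup E] [NormedSpace ℝ E]
  {H : Type*} [TopologicalSpace H] {I : ModelWithCorners ℝ E H}
  {G : Type*} [TopologicalSpace G] [ChartedSpace H G] [Group G]

theorem mcLeft_apply (g : Nerve G 1) (v : Fin 1 → Fin 1 → E) :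
    (mcLeft I G g v : E) = leftMC I (g 0) (v 0 0) :=
  congrArg (leftMC I (g 0)) (modelDeriv_nerve_eval (I := I) g 0 (v 0))

theorem mcRight_apply (g : Nerve G 1) (v : Fin 1 → Fin 1 → E) :
    (mcRight I G g v : E) = rightMC I (g 0) (v 0 0) :=
  congrArg (rightMC I (g 0)) (modelDeriv_nerve_eval (I := I) g 0 (v 0))

theorem wedgeOne_apply {H' : Type*} [TopologicalSpace H']
    {E' : Type*} [NormedAddCommGroup E'] [NormedSpace ℝ E']
    {J : ModelWithCorners ℝ E' H'} {M : Type*} [TopologicalSpace M] [ChartedSpace H' M]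
    {V V₁ V₂ : Type*} [AddCommGroup V] [Module ℝ V] [AddCommGroup V₁] [Module ℝ V₁]
    [AddCommGroup V₂] [Module ℝ V₂] {q : ℕ} (b : V₁ →ₗ[ℝ] V₂ →ₗ[ℝ] V) (α : Form J M V₁ 1)
    (β : Form J M V₂ q) (x : M) (v : Fin (q + 1) → TangentSpace J x) :
    wedgeOne b α β x v =
      ∑ i : Fin (q + 1), (-1 : ℤ) ^ (i : ℕ) • b (α x fun _ => v i) (β x (i.removeNth v)) := by
  rw [wedgeOne, AlternatingMap.alternatizeUncurryFin_apply]
  rfl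

theorem brylinskiWeinstein_apply (B : LinearMap.BilinForm ℝ (GroupLieAlgebra I G)) (g : Nerve G 2)
    (v : Fin 2 → Fin 2 → E) : brylinskiWeinstein B g v =
      formE B (leftMC I (g 0) (v 0 0)) (rightMC I (g 1) (v 1 1)) -
      formE B (leftMC I (g 0) (v 1 0)) (rightMC I (g 1) (v 0 1)) := by
  have h2 : ∀ u : Fin 2 → E, modelDeriv (nerveModel I 2) (nerveModel I 1)
      (face 2 : Nerve G 2 → Nerve G 1) g u 0 = u 0 := by
    intro u
    rw [modelDeriv_nerve (fun i => ?_)]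
    · exact modelDeriv_nerve_eval g 0 u
    · fin_cases i
      exact mdifferentiableAt_nerve_eval g 0
  have h0 : ∀ u : Fin 2 → E, modelDeriv (nerveModel I 2) (nerveModel I 1)
      (face 0 : Nerve G 2 → Nerve G 1) g u 0 = u 1 := by
    intro u
    rw [modelDeriv_nerve (fun i => ?_)]
    · exact modelDeriv_nerve_eval g 1 u
    · fin_cases i
      exact mdifferentiableAt_nerve_eval g 1
  have hl : ∀ u : Fin 2 → E, (pullback (nerveModel I 2) (nerveModel I 1) (face 2) (mcLeft I G) g
      (fun _ => u) : E) = leftMC I (g 0) (u 0) := by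
    intro u
    rw [← h2 u]
    exact mcLeft_apply _ fun _ => modelDeriv (nerveModel I 2) (nerveModel I 1) (face 2) g u
  have hr : ∀ u : Fin 1 → Fin 2 → E, (pullback (nerveModel I 2) (nerveModel I 1) (face 0)
      (mcRight I G) g u : E) = rightMC I (g 1) (u 0 1) := by
    intro u
    rw [← h0 (u 0)]
    exact mcRight_apply _ fun i => modelDeriv (nerveModel I 2) (nerveModel I 1) (face 0) g (u i)
  have h := wedgeOne_apply B (pullback (nerveModel I 2) (nerveModel I 1) (face 2) (mcLeft I G))
    (pullback (nerveModel I 2) (nerveModel I 1) (face 0) (mcRight I G)) g v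
  rw [Fin.sum_univ_two] at h
  have e0 := congrArg₂ (fun a b => formE B a b) (hl (v 0)) (hr (Fin.removeNth 0 v))
  have e1 := congrArg₂ (fun a b => formE B a b) (hl (v 1)) (hr (Fin.removeNth 1 v))
  refine h.trans ?_
  refine (congrArg₂ (fun a b : ℝ => (-1 : ℤ) ^ 0 • a + (-1 : ℤ) ^ 1 • b) e0 e1).trans ?_
  simp only [pow_zero, pow_one, one_smul, neg_smul]
  rw [← sub_eq_add_neg]
  rfl

theorem brylinskiWeinstein_one_apply (B : LinearMap.BilinForm ℝ (GroupLieAlgebra I G))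
    (u w : Fin 2 → E) : brylinskiWeinstein B (1 : Nerve G 2) ![u, w] =
      formE B (u 0) (w 1) - formE B (w 0) (u 1) := by
  refine (brylinskiWeinstein_apply B 1 ![u, w]).trans ?_
  rw [Pi.one_apply, Pi.one_apply, leftMC_one, rightMC_one]
  rfl

/-- The Brylinski-Weinstein form has constant coefficients in the coframe `(d₂^*θ^l, d₀^*θ^r)`. -/
theorem brylinskiWeinstein_eq_coframe (B : LinearMap.BilinForm ℝ (GroupLieAlgebra I G))
    (g : Nerve G 2) (v : Fin 2 → Fin 2 → E) : brylinskiWeinstein B g v =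
      (show (Fin 2 → E) [⋀^Fin 2]→ₗ[ℝ] ℝ from brylinskiWeinstein B (1 : Nerve G 2))
        fun i => productCoframe ![leftMC I, rightMC I] g (v i) := by
  refine (brylinskiWeinstein_apply B g v).trans (Eq.symm ?_)
  refine (brylinskiWeinstein_apply B 1 _).trans ?_
  rw [Pi.one_apply, Pi.one_apply, leftMC_one, rightMC_one]
  rfl

variable [CompleteSpace E] [LieGroup I ∞ G]

/-- The Cartan trilinear form `⟨a, [b, c]⟩` is cyclically invariant. -/
theorem formE_brE_rotate {B : LinearMap.BilinForm ℝ (GroupLieAlgebra I G)} (hB : IsQuadratic B)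
    (a b c : E) : formE B a (brE I G b c) = formE B b (brE I G c a) := by
  have h := formE_invariant hB c a b
  rw [brE_skew b c, map_neg, formE_symm hB b]
  linarith

/-- The six terms of the wedge product agree, which cancels the factor `1/6`. -/
theorem cartanForm_apply {B : LinearMap.BilinForm ℝ (GroupLieAlgebra I G)} (hB : IsQuadratic B)
    (g : Nerve G 1) (v : Fin 3 → Fin 1 → E) : cartanForm B g v =
      formE B (leftMC I (g 0) (v 0 0))
        (brE I G (leftMC I (g 0) (v 1 0)) (leftMC I (g 0) (v 2 0))) := by
  have hbr : ∀ u : Fin 2 → Fin 1 → E,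
      (wedgeOne (bracketBilin I G) (mcLeft I G) (mcLeft I G) g u : E) =
        (2 : ℝ) • brE I G (leftMC I (g 0) (u 0 0)) (leftMC I (g 0) (u 1 0)) := by
    intro u
    have h := wedgeOne_apply (bracketBilin I G) (mcLeft I G) (mcLeft I G) g u
    rw [Fin.sum_univ_two] at h
    have e0 := congrArg₂ (fun a b => brE I G a b) (mcLeft_apply (I := I) g fun _ => u 0)
      (mcLeft_apply (I := I) g (Fin.removeNth 0 u))
    have e1 := congrArg₂ (fun a b => brE I G a b) (mcLeft_apply (I := I) g fun _ => u 1)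
      (mcLeft_apply (I := I) g (Fin.removeNth 1 u))
    refine h.trans ?_
    refine (congrArg₂ (fun a b : E => (-1 : ℤ) ^ 0 • a + (-1 : ℤ) ^ 1 • b) e0 e1).trans ?_
    simp only [pow_zero, pow_one, one_smul, neg_smul]
    rw [brE_skew (leftMC I (g 0) (u 1 0)), two_smul, neg_neg]
    rfl
  have h := wedgeOne_apply B (mcLeft I G)
    (wedgeOne (bracketBilin I G) (mcLeft I G) (mcLeft I G)) g v
  rw [Fin.sum_univ_three] at h
  have e0 := congrArg₂ (fun a b => formE B a b) (mcLeft_apply (I := I) g fun _ => v 0)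
    (hbr (Fin.removeNth 0 v))
  have e1 := congrArg₂ (fun a b => formE B a b) (mcLeft_apply (I := I) g fun _ => v 1)
    (hbr (Fin.removeNth 1 v))
  have e2 := congrArg₂ (fun a b => formE B a b) (mcLeft_apply (I := I) g fun _ => v 2)
    (hbr (Fin.removeNth 2 v))
  have h' : wedgeOne B (mcLeft I G)
      (wedgeOne (bracketBilin I G) (mcLeft I G) (mcLeft I G)) g v = _ :=
    h.trans (congrArg₂ (fun a b : ℝ => a + b)
      (congrArg₂ (fun a b : ℝ => (-1 : ℤ) ^ 0 • a + (-1 : ℤ) ^ 1 • b) e0 e1)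
      (congrArg (fun a : ℝ => (-1 : ℤ) ^ 2 • a) e2))
  have hs : cartanForm B g v = (1 / 6 : ℝ) * wedgeOne B (mcLeft I G)
      (wedgeOne (bracketBilin I G) (mcLeft I G) (mcLeft I G)) g v := rfl
  rw [hs, h']
  have r00 : (Fin.removeNth 0 v) 0 = v 1 := rfl
  have r01 : (Fin.removeNth 0 v) 1 = v 2 := rfl
  have r10 : (Fin.removeNth 1 v) 0 = v 0 := rfl
  have r11 : (Fin.removeNth 1 v) 1 = v 2 := rfl
  have r20 : (Fin.removeNth 2 v) 0 = v 0 := rfl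
  have r21 : (Fin.removeNth 2 v) 1 = v 1 := rfl
  simp only [r00, r01, r10, r11, r20, r21, map_smul, smul_eq_mul, zsmul_eq_mul]
  rw [formE_brE_rotate hB (leftMC I (g 0) (v 2 0)), formE_brE_rotate hB (leftMC I (g 0) (v 1 0)),
    brE_skew (leftMC I (g 0) (v 2 0)) (leftMC I (g 0) (v 1 0)), map_neg]
  push_cast
  ring

/-- The Cartan form has constant coefficients in the coframe `θ^l`. -/
theorem cartanForm_eq_coframe {B : LinearMap.BilinForm ℝ (GroupLieAlgebra I G)}
    (hB : IsQuadratic B) (g : Nerve G 1) (v : Fin 3 → Fin 1 → E) : cartanForm B g v =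
      (show (Fin 1 → E) [⋀^Fin 3]→ₗ[ℝ] ℝ from cartanForm B (1 : Nerve G 1))
        fun i => productCoframe ![leftMC I] g (v i) := by
  refine (cartanForm_apply hB g v).trans (Eq.symm ?_)
  refine (cartanForm_apply hB 1 _).trans ?_
  rw [Pi.one_apply, leftMC_one]
  rfl

end Evaluation

/-! ### Degeneracies and faces on tangent vectors -/

section TangentMaps

variable {E : Type*} [NormedAddCommGroup E] [NormedSpace ℝ E]
  {H : Type*} [TopologicalSpace H] {I : ModelWithCorners ℝ E H}
  {E' : Type*} [NormedAddCommGroup E'] [NormedSpace ℝ E']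
  {H' : Type*} [TopologicalSpace H'] {J : ModelWithCorners ℝ E' H'}
  {M : Type*} [TopologicalSpace M] [ChartedSpace H' M]
  {G : Type*} [TopologicalSpace G] [ChartedSpace H G]

theorem modelDeriv_const (c : G) (x : M) (v : E') : modelDeriv J I (fun _ : M => c) x v = 0 :=
  congrArg (fun L : E' →L[ℝ] E => L v) (mfderiv_const (I := J) (I' := I) (c := c) (x := x))

theorem pullback_eval {p p' q : ℕ} (f : Nerve G p → Nerve G p')
    (η : Form (nerveModel I p') (Nerve G p') ℝ q)
    (g : Nerve G p) (v : Fin q → Fin p → E) :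
    pullback (nerveModel I p) (nerveModel I p') f η g v =
      η (f g) fun j => modelDeriv (nerveModel I p) (nerveModel I p') f g (v j) :=
  rfl

/-- All forms of positive degree on the point `G^0` vanish. -/
theorem form_nerve_zero_eq_zero {q : ℕ} (η : Form (nerveModel I 0) (Nerve G 0) ℝ (q + 1)) :
    η = 0 := by
  funext g
  refine AlternatingMap.ext fun v => ?_
  exact (η g).map_coord_zero 0 (Subsingleton.elim (α := Fin 0 → E) _ _)

variable [Group G]

theorem simpD_eval {p q : ℕ} (η : NForm I G p q) (g : Nerve G (p + 1))
    (v : Fin q → Fin (p + 1) → E) :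
    simpD η g v = ∑ i : Fin (p + 2), (-1 : ℝ) ^ (i : ℕ) *
      η (face i g) fun j =>
        modelDeriv (nerveModel I (p + 1)) (nerveModel I p) (face i) g (v j) := by
  rw [simpD, Finset.sum_apply]
  exact map_sum (⟨⟨fun f => f v, rfl⟩, fun _ _ => rfl⟩ :
    ((Fin (p + 1) → E) [⋀^Fin q]→ₗ[ℝ] ℝ) →+ ℝ) _ _

theorem modelDeriv_degen_zero_of_one (g : Nerve G 1) (v : Fin 1 → E) :
    modelDeriv (nerveModel I 1) (nerveModel I 2) (degen 0) g v = ![0, v 0] := by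
  have h : ∀ i : Fin 2, MDifferentiableAt (nerveModel I 1) I
      (fun y : Nerve G 1 => (degen 0 y : Nerve G 2) i) g := by
    intro i
    fin_cases i
    · exact mdifferentiableAt_const
    · exact mdifferentiableAt_nerve_eval g 0
  funext i
  rw [modelDeriv_nerve h]
  fin_cases i
  · exact modelDeriv_const (1 : G) g v
  · exact modelDeriv_nerve_eval g 0 v

theorem modelDeriv_degen_one_of_one (g : Nerve G 1) (v : Fin 1 → E) :
    modelDeriv (nerveModel I 1) (nerveModel I 2) (degen 1) g v = ![v 0, 0] := by
  have h : ∀ i : Fin 2, MDifferentiableAt (nerveModel I 1) I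
      (fun y : Nerve G 1 => (degen 1 y : Nerve G 2) i) g := by
    intro i
    fin_cases i
    · exact mdifferentiableAt_nerve_eval g 0
    · exact mdifferentiableAt_const
  funext i
  rw [modelDeriv_nerve h]
  fin_cases i
  · exact modelDeriv_nerve_eval g 0 v
  · exact modelDeriv_const (1 : G) g v

/-- A component of a face map that is a projection. -/
theorem modelDeriv_face_eval {p : ℕ} {i : Fin (p + 2)} {k : Fin p} {m : Fin (p + 1)}
    {g : Nerve G (p + 1)}
    (h : ∀ k, MDifferentiableAt (nerveModel I (p + 1)) I
      (fun y : Nerve G (p + 1) => (face i y : Nerve G p) k) g)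
    (hk : ∀ y : Nerve G (p + 1), (face i y : Nerve G p) k = y m) (v : Fin (p + 1) → E) :
    modelDeriv (nerveModel I (p + 1)) (nerveModel I p) (face i) g v k = v m := by
  rw [modelDeriv_nerve h]
  simp only [hk]
  exact modelDeriv_nerve_eval g m v

end TangentMaps

section FaceMul

variable {E : Type*} [NormedAddCommGroup E] [NormedSpace ℝ E]
  {H : Type*} [TopologicalSpace H] {I : ModelWithCorners ℝ E H}
  {G : Type*} [TopologicalSpace G] [ChartedSpace H G] [Group G] [LieGroup I ∞ G]

theorem mdifferentiableAt_face {p : ℕ} (i : Fin (p + 2)) (k : Fin p) (g : Nerve G (p + 1)) :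
    MDifferentiableAt (nerveModel I (p + 1)) I
      (fun y : Nerve G (p + 1) => (face i y : Nerve G p) k) g := by
  refine Fin.cases ?_ (fun j => ?_) i
  · exact mdifferentiableAt_nerve_eval g k.succ
  · simp only [face, Fin.cases_succ, Fin.contractNth]
    split_ifs
    · exact mdifferentiableAt_nerve_eval g _
    · exact mdifferentiableAt_mul (mdifferentiableAt_nerve_eval g _)
        (mdifferentiableAt_nerve_eval g _)
    · exact mdifferentiableAt_nerve_eval g _

/-- The left Maurer-Cartan form on a component of a face map that is a product. -/
theorem leftMC_modelDeriv_face_mul {p : ℕ} {i : Fin (p + 2)} {k : Fin p} {m n : Fin (p + 1)}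
    (hk : ∀ y : Nerve G (p + 1), (face i y : Nerve G p) k = y m * y n) (g : Nerve G (p + 1))
    (v : Fin (p + 1) → E) :
    leftMC I ((face i g : Nerve G p) k)
        (modelDeriv (nerveModel I (p + 1)) (nerveModel I p) (face i) g v k) =
      adE I (g n)⁻¹ (leftMC I (g m) (v m)) + leftMC I (g n) (v n) := by
  rw [modelDeriv_nerve fun k => mdifferentiableAt_face i k g]
  simp only [hk]
  rw [leftMC_modelDeriv_mul (mdifferentiableAt_nerve_eval g m) (mdifferentiableAt_nerve_eval g n),
    modelDeriv_nerve_eval, modelDeriv_nerve_eval]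

/-- The right Maurer-Cartan form on a component of a face map that is a product. -/
theorem rightMC_modelDeriv_face_mul {p : ℕ} {i : Fin (p + 2)} {k : Fin p} {m n : Fin (p + 1)}
    (hk : ∀ y : Nerve G (p + 1), (face i y : Nerve G p) k = y m * y n) (g : Nerve G (p + 1))
    (v : Fin (p + 1) → E) :
    rightMC I ((face i g : Nerve G p) k)
        (modelDeriv (nerveModel I (p + 1)) (nerveModel I p) (face i) g v k) =
      rightMC I (g m) (v m) + adE I (g m) (rightMC I (g n) (v n)) := by
  rw [modelDeriv_nerve fun k => mdifferentiableAt_face i k g]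
  simp only [hk]
  rw [rightMC_modelDeriv_mul (mdifferentiableAt_nerve_eval g m) (mdifferentiableAt_nerve_eval g n),
    modelDeriv_nerve_eval, modelDeriv_nerve_eval]

end FaceMul

/-! ### Smoothness and normalization -/

section Normalized

variable {E : Type*} [NormedAddCommGroup E] [NormedSpace ℝ E]
  {H : Type*} [TopologicalSpace H] {I : ModelWithCorners ℝ E H}
  {G : Type*} [TopologicalSpace G] [ChartedSpace H G] [Group G]

theorem isNormalized_brylinskiWeinstein (B : LinearMap.BilinForm ℝ (GroupLieAlgebra I G)) :
    IsNormalized (brylinskiWeinstein B) := by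
  intro i
  funext g
  have h : ∀ v : Fin 2 → Fin 1 → E, pullback (nerveModel I 1) (nerveModel I 2) (degen i)
      (brylinskiWeinstein B) g v = 0 := by
    intro v
    rw [pullback_eval, brylinskiWeinstein_apply]
    fin_cases i
    · simp only [Fin.zero_eta, modelDeriv_degen_zero_of_one]
      simp
    · simp only [Fin.mk_one, modelDeriv_degen_one_of_one]
      simp
  exact AlternatingMap.ext h

section Coframes

variable [LieGroup I ∞ G] [I.Boundaryless]

theorem contDiffOn_leftMC_rightMC_inChart (i : Fin 2) (x : G) :
    ContDiffOn ℝ ∞ (coframeInChart I ((![leftMC I, rightMC I] : Fin 2 → G → E →L[ℝ] E) i) x)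
      (extChartAt I x).target := by
  fin_cases i
  · exact contDiffOn_leftMC_inChart x
  · exact contDiffOn_rightMC_inChart x

theorem contDiffOn_singleton_leftMC_inChart (i : Fin 1) (x : G) :
    ContDiffOn ℝ ∞ (coframeInChart I ((![leftMC I] : Fin 1 → G → E →L[ℝ] E) i) x)
      (extChartAt I x).target := by
  fin_cases i
  exact contDiffOn_leftMC_inChart x

variable [FiniteDimensional ℝ E]

theorem isSmoothForm_brylinskiWeinstein (B : LinearMap.BilinForm ℝ (GroupLieAlgebra I G)) :
    IsSmoothForm (brylinskiWeinstein B) := fun x =>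
  contDiffOn_inChart_of_coframe (brylinskiWeinstein_eq_coframe B)
    (contDiffOn_productCoframe_inChart contDiffOn_leftMC_rightMC_inChart x)

end Coframes

variable [CompleteSpace E] [LieGroup I ∞ G]

theorem neg_cartanForm_eq_coframe {B : LinearMap.BilinForm ℝ (GroupLieAlgebra I G)}
    (hB : IsQuadratic B) (g : Nerve G 1) (v : Fin 3 → Fin 1 → E) :
    (-cartanForm B : NForm I G 1 3) g v =
      (-(show (Fin 1 → E) [⋀^Fin 3]→ₗ[ℝ] ℝ from cartanForm B (1 : Nerve G 1)))
        fun i => productCoframe ![leftMC I] g (v i) :=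
  congrArg Neg.neg (cartanForm_eq_coframe hB g v)

theorem isNormalized_neg_cartanForm (B : LinearMap.BilinForm ℝ (GroupLieAlgebra I G)) :
    IsNormalized (-cartanForm B : NForm I G 1 3) := by
  intro i
  exact form_nerve_zero_eq_zero _

variable [I.Boundaryless] [FiniteDimensional ℝ E]

theorem isSmoothForm_neg_cartanForm {B : LinearMap.BilinForm ℝ (GroupLieAlgebra I G)}
    (hB : IsQuadratic B) : IsSmoothForm (-cartanForm B : NForm I G 1 3) := fun x =>
  contDiffOn_inChart_of_coframe (neg_cartanForm_eq_coframe hB)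
    (contDiffOn_productCoframe_inChart contDiffOn_singleton_leftMC_inChart x)

theorem omegaForm_normalized {B : LinearMap.BilinForm ℝ (GroupLieAlgebra I G)}
    (hB : IsQuadratic B) : (omegaForm B).Normalized where
  two := ⟨isSmoothForm_brylinskiWeinstein B, isNormalized_brylinskiWeinstein B⟩
  one := ⟨isSmoothForm_neg_cartanForm hB, isNormalized_neg_cartanForm B⟩
  zero := ⟨fun x => show ContDiffOn ℝ ∞ (fun _ => 0) (extChartAt (nerveModel I 0) x).target from
    contDiffOn_const, trivial⟩

end Normalized

/-! ### Closedness -/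

section Closed

variable {E : Type*} [NormedAddCommGroup E] [NormedSpace ℝ E]
  {H : Type*} [TopologicalSpace H] {I : ModelWithCorners ℝ E H}
  {G : Type*} [TopologicalSpace G] [ChartedSpace H G] [Group G]
  [LieGroup I ∞ G]

/-- The multiplicativity of the Maurer-Cartan forms and the `Ad`-invariance of the pairing make
the four pullbacks of `Ω` cancel. -/
theorem simpD_brylinskiWeinstein {B : LinearMap.BilinForm ℝ (GroupLieAlgebra I G)}
    (hAd : AdInvariant B) : simpD (brylinskiWeinstein B) = 0 := by
  funext g
  refine AlternatingMap.ext (show ∀ v : Fin 2 → Fin 3 → E, simpD (brylinskiWeinstein B) g v = 0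
    from fun v => ?_)
  rw [simpD_eval]
  have hd := fun (i : Fin 4) (k : Fin 2) => mdifferentiableAt_face (I := I) i k g
  have key : ∀ a b : E, formE B (adE I (g 1)⁻¹ a) b = formE B a (adE I (g 1) b) := fun a b => by
    rw [← adInvariant_iff_formE.1 hAd (g 1), adE_self_apply_inv]
  rw [Fin.sum_univ_four]
  simp only [brylinskiWeinstein_apply]
  have h00 : ∀ u : Fin 3 → E, modelDeriv (nerveModel I 3) (nerveModel I 2) (face 0) g u 0 = u 1 :=
    modelDeriv_face_eval (hd 0) fun _ => rfl
  have h01 : ∀ u : Fin 3 → E, modelDeriv (nerveModel I 3) (nerveModel I 2) (face 0) g u 1 = u 2 :=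
    modelDeriv_face_eval (hd 0) fun _ => rfl
  have h11 : ∀ u : Fin 3 → E, modelDeriv (nerveModel I 3) (nerveModel I 2) (face 1) g u 1 = u 2 :=
    modelDeriv_face_eval (hd 1) fun _ => rfl
  have h20 : ∀ u : Fin 3 → E, modelDeriv (nerveModel I 3) (nerveModel I 2) (face 2) g u 0 = u 0 :=
    modelDeriv_face_eval (hd 2) fun _ => rfl
  have h30 : ∀ u : Fin 3 → E, modelDeriv (nerveModel I 3) (nerveModel I 2) (face 3) g u 0 = u 0 :=
    modelDeriv_face_eval (hd 3) fun _ => rfl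
  have h31 : ∀ u : Fin 3 → E, modelDeriv (nerveModel I 3) (nerveModel I 2) (face 3) g u 1 = u 1 :=
    modelDeriv_face_eval (hd 3) fun _ => rfl
  have h10 := leftMC_modelDeriv_face_mul (I := I) (i := (1 : Fin 4)) (k := (0 : Fin 2)) (m := 0)
    (n := 1) (fun _ => rfl) g
  have h21 := rightMC_modelDeriv_face_mul (I := I) (i := (2 : Fin 4)) (k := (1 : Fin 2)) (m := 1)
    (n := 2) (fun _ => rfl) g
  simp only [h10, h21, h00, h01, h11, h20, h30, h31, map_add, LinearMap.add_apply, key]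
  have f00 : (face 0 g : Nerve G 2) 0 = g 1 := rfl
  have f01 : (face 0 g : Nerve G 2) 1 = g 2 := rfl
  have f11 : (face 1 g : Nerve G 2) 1 = g 2 := rfl
  have f20 : (face 2 g : Nerve G 2) 0 = g 0 := rfl
  have f30 : (face 3 g : Nerve G 2) 0 = g 0 := rfl
  have f31 : (face 3 g : Nerve G 2) 1 = g 1 := rfl
  simp only [f00, f01, f11, f20, f30, f31]
  norm_num
  ring

variable [CompleteSpace E]

/-- The `Ad`-invariance of the Cartan trilinear form. -/
theorem formE_brE_adE {B : LinearMap.BilinForm ℝ (GroupLieAlgebra I G)} [I.Boundaryless]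
    (hAd : AdInvariant B) (h : G) (a b c : E) :
    formE B (adE I h a) (brE I G (adE I h b) (adE I h c)) = formE B a (brE I G b c) := by
  rw [← adE_brE, adInvariant_iff_formE.1 hAd]

end Closed

section BracketE

variable {E : Type*} [NormedAddCommGroup E] [NormedSpace ℝ E] [CompleteSpace E]
  {H : Type*} [TopologicalSpace H] {I : ModelWithCorners ℝ E H}
  {G : Type*} [TopologicalSpace G] [ChartedSpace H G] [Group G] [LieGroup I ∞ G]

theorem brE_add_left (a b c : E) : brE I G (a + b) c = brE I G a c + brE I G b c :=
  (add_lie : ∀ a b c : GroupLieAlgebra I G, ⁅a + b, c⁆ = ⁅a, c⁆ + ⁅b, c⁆) a b c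

theorem brE_add_right (a b c : E) : brE I G a (b + c) = brE I G a b + brE I G a c :=
  (lie_add : ∀ a b c : GroupLieAlgebra I G, ⁅a, b + c⁆ = ⁅a, b⁆ + ⁅a, c⁆) a b c

theorem brE_jacobi (a b c : E) :
    brE I G a (brE I G b c) + brE I G b (brE I G c a) + brE I G c (brE I G a b) = 0 :=
  (lie_jacobi : ∀ a b c : GroupLieAlgebra I G, ⁅a, ⁅b, c⁆⁆ + ⁅b, ⁅c, a⁆⁆ + ⁅c, ⁅a, b⁆⁆ = 0) a b c

end BracketE

section ZeroForm

variable {E : Type*} [NormedAddCommGroup E] [NormedSpace ℝ E]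
  {H : Type*} [TopologicalSpace H] {I : ModelWithCorners ℝ E H}
  {G : Type*} [TopologicalSpace G] [ChartedSpace H G] [Group G]

theorem simpD_zero (p q : ℕ) : simpD (0 : NForm I G p q) = 0 := by
  funext g
  refine AlternatingMap.ext (show ∀ v : Fin q → Fin (p + 1) → E,
    simpD (0 : NForm I G p q) g v = 0 from fun v => ?_)
  rw [simpD_eval]
  exact Finset.sum_eq_zero fun i _ => mul_zero _

end ZeroForm

section ClosedCartan

variable {E : Type*} [NormedAddCommGroup E] [NormedSpace ℝ E]
  {H : Type*} [TopologicalSpace H] {I : ModelWithCorners ℝ E H} [I.Boundaryless]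
  {G : Type*} [TopologicalSpace G] [ChartedSpace H G] [Group G]
  [CompleteSpace E] [LieGroup I ∞ G]

/-- With `l = d₂^*θ^l` and `r = d₀^*θ^r` one has `d₀^*θ^l = Ad_h⁻¹ r` and
`d₁^*θ^l = Ad_h⁻¹(l + r)` at `(g, h)`, so `Ad`-invariance expresses `δΘ` through the Cartan
trilinear form of `l`, `r` and `l + r`. -/
theorem simpD_cartanForm_eval {B : LinearMap.BilinForm ℝ (GroupLieAlgebra I G)}
    (hB : IsQuadratic B) (hAd : AdInvariant B) (g : Nerve G 2) (v : Fin 3 → Fin 2 → E)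
    (l r : Fin 3 → E) (hl : ∀ j, leftMC I (g 0) (v j 0) = l j)
    (hr : ∀ j, rightMC I (g 1) (v j 1) = r j) :
    simpD (cartanForm B) g v = formE B (r 0) (brE I G (r 1) (r 2)) -
      formE B (l 0 + r 0) (brE I G (l 1 + r 1) (l 2 + r 2)) +
      formE B (l 0) (brE I G (l 1) (l 2)) := by
  have hd := fun (i : Fin 3) (k : Fin 1) => mdifferentiableAt_face (I := I) i k g
  rw [simpD_eval, Fin.sum_univ_three]
  simp only [cartanForm_apply hB]
  have h0 : ∀ u : Fin 2 → E, modelDeriv (nerveModel I 2) (nerveModel I 1) (face 0) g u 0 = u 1 :=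
    modelDeriv_face_eval (hd 0) fun _ => rfl
  have h2 : ∀ u : Fin 2 → E, modelDeriv (nerveModel I 2) (nerveModel I 1) (face 2) g u 0 = u 0 :=
    modelDeriv_face_eval (hd 2) fun _ => rfl
  have h1 := leftMC_modelDeriv_face_mul (I := I) (i := (1 : Fin 3)) (k := (0 : Fin 1)) (m := 0)
    (n := 1) (fun _ => rfl) g
  have f0 : (face 0 g : Nerve G 1) 0 = g 1 := rfl
  have f2 : (face 2 g : Nerve G 1) 0 = g 0 := rfl
  simp only [h1, h0, h2, f0, f2, leftMC_eq (g 1), hl, hr, ← map_add, formE_brE_adE hAd]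
  norm_num
  ring

variable [FiniteDimensional ℝ E]

/-- The structure equations turn `dΩ` into Cartan terms that are mixed in `d₂^*θ^l` and
`d₀^*θ^r`. -/
theorem extD_brylinskiWeinstein_eval (B : LinearMap.BilinForm ℝ (GroupLieAlgebra I G))
    (g : Nerve G 2) (v : Fin 3 → Fin 2 → E) :
    extD (brylinskiWeinstein B) g v =
      (-formE B (brE I G (leftMC I (g 0) (v 0 0)) (leftMC I (g 0) (v 1 0)))
          (rightMC I (g 1) (v 2 1))
        - formE B (leftMC I (g 0) (v 2 0))
          (brE I G (rightMC I (g 1) (v 0 1)) (rightMC I (g 1) (v 1 1))))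
      - (-formE B (brE I G (leftMC I (g 0) (v 0 0)) (leftMC I (g 0) (v 2 0)))
          (rightMC I (g 1) (v 1 1))
        - formE B (leftMC I (g 0) (v 1 0))
          (brE I G (rightMC I (g 1) (v 0 1)) (rightMC I (g 1) (v 2 1))))
      + (-formE B (brE I G (leftMC I (g 0) (v 1 0)) (leftMC I (g 0) (v 2 0)))
          (rightMC I (g 1) (v 0 1))
        - formE B (leftMC I (g 0) (v 0 0))
          (brE I G (rightMC I (g 1) (v 1 1)) (rightMC I (g 1) (v 2 1)))) := by
  have hK : ∀ (i : Fin 2) (u w : E),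
      fderiv ℝ (coframeInChart I ((![leftMC I, rightMC I] : Fin 2 → G → E →L[ℝ] E) i) (g i))
          (extChartAt I (g i) (g i)) u w -
        fderiv ℝ (coframeInChart I ((![leftMC I, rightMC I] : Fin 2 → G → E →L[ℝ] E) i) (g i))
          (extChartAt I (g i) (g i)) w u =
        (![fun a b => -brE I G a b, brE I G] : Fin 2 → E → E → E) i
          ((![leftMC I, rightMC I] : Fin 2 → G → E →L[ℝ] E) i (g i) u)
          ((![leftMC I, rightMC I] : Fin 2 → G → E →L[ℝ] E) i (g i) w) := by
    intro i u w
    fin_cases i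
    · exact fderiv_leftMC_inChart (g 0) u w
    · exact fderiv_rightMC_inChart (g 1) u w
  rw [extD_two_of_coframe (brylinskiWeinstein_eq_coframe B)
    (contDiffOn_productCoframe_inChart contDiffOn_leftMC_rightMC_inChart g)
    (K := fun a b i => (![fun a b => -brE I G a b, brE I G] : Fin 2 → E → E → E) i (a i) (b i))
    (fderiv_productCoframe_inChart contDiffOn_leftMC_rightMC_inChart hK)]
  refine (congrArg₂ (· + ·) (congrArg₂ (· - ·) (brylinskiWeinstein_one_apply B _ _)
    (brylinskiWeinstein_one_apply B _ _)) (brylinskiWeinstein_one_apply B _ _)).trans ?_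
  simp [productCoframe_apply]

/-- `δ(-Θ) + dΩ = 0`: both terms consist of the mixed Cartan terms, with opposite signs. -/
theorem simpD_neg_cartanForm_add_extD_brylinskiWeinstein
    {B : LinearMap.BilinForm ℝ (GroupLieAlgebra I G)} (hB : IsQuadratic B) (hAd : AdInvariant B) :
    simpD (-cartanForm B : NForm I G 1 3) + extD (brylinskiWeinstein B) = 0 := by
  funext g
  refine AlternatingMap.ext (show ∀ v : Fin 3 → Fin 2 → E,
    simpD (-cartanForm B : NForm I G 1 3) g v + extD (brylinskiWeinstein B) g v = 0 from
    fun v => ?_)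
  have hneg : simpD (-cartanForm B : NForm I G 1 3) g v = -simpD (cartanForm B) g v := by
    rw [simpD_eval, simpD_eval, ← Finset.sum_neg_distrib]
    exact Finset.sum_congr rfl fun i _ => mul_neg _ _
  rw [hneg, simpD_cartanForm_eval hB hAd g v (fun j => leftMC I (g 0) (v j 0))
    (fun j => rightMC I (g 1) (v j 1)) (fun _ => rfl) fun _ => rfl, extD_brylinskiWeinstein_eval]
  generalize leftMC I (g 0) (v 0 0) = l₀
  generalize leftMC I (g 0) (v 1 0) = l₁
  generalize leftMC I (g 0) (v 2 0) = l₂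
  generalize rightMC I (g 1) (v 0 1) = r₀
  generalize rightMC I (g 1) (v 1 1) = r₁
  generalize rightMC I (g 1) (v 2 1) = r₂
  simp only [brE_add_left, brE_add_right, map_add, LinearMap.add_apply]
  rw [formE_symm hB (brE I G l₀ l₁), formE_symm hB (brE I G l₀ l₂), formE_symm hB (brE I G l₁ l₂),
    formE_brE_rotate hB r₂, formE_brE_rotate hB r₁ l₀ l₂, formE_brE_rotate hB l₂ r₀ r₁,
    formE_brE_rotate hB l₁ r₀ r₂,
    brE_skew l₂ r₁, brE_skew r₂ l₁, map_neg, map_neg]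
  ring

theorem extD_neg_cartanForm {B : LinearMap.BilinForm ℝ (GroupLieAlgebra I G)}
    (hB : IsQuadratic B) : extD (-cartanForm B : NForm I G 1 3) = 0 := by
  funext g
  refine AlternatingMap.ext (show ∀ v : Fin 4 → Fin 1 → E,
    extD (-cartanForm B : NForm I G 1 3) g v = 0 from fun v => ?_)
  have hK : ∀ (i : Fin 1) (u w : E),
      fderiv ℝ (coframeInChart I ((![leftMC I] : Fin 1 → G → E →L[ℝ] E) i) (g i))
          (extChartAt I (g i) (g i)) u w -
        fderiv ℝ (coframeInChart I ((![leftMC I] : Fin 1 → G → E →L[ℝ] E) i) (g i))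
          (extChartAt I (g i) (g i)) w u =
        -brE I G ((![leftMC I] : Fin 1 → G → E →L[ℝ] E) i (g i) u)
          ((![leftMC I] : Fin 1 → G → E →L[ℝ] E) i (g i) w) := by
    intro i u w
    fin_cases i
    exact fderiv_leftMC_inChart (g 0) u w
  rw [extD_three_of_coframe (neg_cartanForm_eq_coframe hB)
    (contDiffOn_productCoframe_inChart contDiffOn_singleton_leftMC_inChart g)
    (K := fun a b i => -brE I G (a i) (b i))
    (fderiv_productCoframe_inChart (K := fun _ a b => -brE I G a b)
      contDiffOn_singleton_leftMC_inChart hK)]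
  have h : ∀ a b c : Fin 1 → E,
      (-(show (Fin 1 → E) [⋀^Fin 3]→ₗ[ℝ] ℝ from cartanForm B (1 : Nerve G 1))) ![a, b, c] =
        -formE B (a 0) (brE I G (b 0) (c 0)) := by
    intro a b c
    refine congrArg Neg.neg ((cartanForm_apply hB (1 : Nerve G 1) ![a, b, c]).trans ?_)
    rw [Pi.one_apply, leftMC_one]
    rfl
  simp only [h, productCoframe_apply]
  simp only [Matrix.cons_val_fin_one]
  generalize leftMC I (g 0) (v 0 0) = l₀
  generalize leftMC I (g 0) (v 1 0) = l₁
  generalize leftMC I (g 0) (v 2 0) = l₂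
  generalize leftMC I (g 0) (v 3 0) = l₃
  -- Rotate all six terms to `⟨l₀, [·, [·, ·]]⟩`; what remains is the Jacobi identity.
  simp only [map_neg, LinearMap.neg_apply, neg_neg]
  rw [formE_symm hB (brE I G l₀ l₁), formE_symm hB (brE I G l₀ l₂), formE_symm hB (brE I G l₀ l₃),
    formE_brE_rotate hB _ l₀ l₁, formE_brE_rotate hB _ l₀ l₂, formE_brE_rotate hB _ l₀ l₃]
  have hJ := congrArg (formE B l₀) (brE_jacobi (I := I) (G := G) l₁ l₂ l₃)
  rw [brE_skew l₃ l₁, map_add, map_add, map_zero] at hJ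
  have hn : brE I G l₂ (-brE I G l₁ l₃) = -brE I G l₂ (brE I G l₁ l₃) :=
    (lie_neg : ∀ a b : GroupLieAlgebra I G, ⁅a, -b⁆ = -⁅a, b⁆) _ _
  rw [hn, map_neg] at hJ
  linarith

theorem omegaForm_closed {B : LinearMap.BilinForm ℝ (GroupLieAlgebra I G)}
    (hB : IsQuadratic B) (hAd : AdInvariant B) : (omegaForm B).Closed where
  three := simpD_brylinskiWeinstein hAd
  two := simpD_neg_cartanForm_add_extD_brylinskiWeinstein hB hAd
  one := by
    refine (congrArg₂ (· - ·) (simpD_zero 0 4) (extD_neg_cartanForm hB)).trans ?_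
    exact sub_zero _
  zero := form_nerve_zero_eq_zero _

end ClosedCartan

/-! ### The tangent complex and non-degeneracy -/

section TangentComplex

variable {E : Type*} [NormedAddCommGroup E] [NormedSpace ℝ E]
  {H : Type*} [TopologicalSpace H] {I : ModelWithCorners ℝ E H}
  {G : Type*} [TopologicalSpace G] [ChartedSpace H G] [Group G]

theorem degenT_zero_of_one (v : Fin 1 → E) :
    (degenT (I := I) (G := G) (l := 1) 0 v : Fin 2 → E) = ![0, v 0] :=
  modelDeriv_degen_zero_of_one (1 : Nerve G 1) v

theorem degenT_one_of_one (v : Fin 1 → E) :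
    (degenT (I := I) (G := G) (l := 1) 1 v : Fin 2 → E) = ![v 0, 0] :=
  modelDeriv_degen_one_of_one (1 : Nerve G 1) v

instance subsingleton_tangentSpace_nerve_zero :
    Subsingleton (TangentSpace (nerveModel I 0) (1 : Nerve G 0)) :=
  inferInstanceAs (Subsingleton (Fin 0 → E))

variable (I G) in
theorem boundaries_zero : boundaries I G 0 = ⊤ := Subsingleton.elim _ _

variable (I G) in
theorem mem_cycles_one (v : TangentSpace (nerveModel I 1) (1 : Nerve G 1)) : v ∈ cycles I G 1 := by
  refine ⟨?_, Subsingleton.elim _ _⟩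
  exact (Submodule.mem_iInf _).2 fun _ => Subsingleton.elim (α := Fin 0 → E) _ _

variable [LieGroup I ∞ G]

/-- The kernels of `T_e d₀` and `T_e d₁` on `𝔤²` are `v₁ = 0` and `v₀ + v₁ = 0`. -/
theorem tangentCx_two : tangentCx I G 2 = ⊥ := by
  rw [eq_bot_iff]
  intro v hv
  have hv' := (Submodule.mem_iInf _).1 hv
  have h0 : modelDeriv (nerveModel I 2) (nerveModel I 1) (face 0) (1 : Nerve G 2) v = 0 := hv' 0
  have h1 : modelDeriv (nerveModel I 2) (nerveModel I 1) (face 1) (1 : Nerve G 2) v = 0 := hv' 1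
  have hd := fun (i : Fin 3) (k : Fin 1) => mdifferentiableAt_face (I := I) i k (1 : Nerve G 2)
  have e0 := modelDeriv_face_eval (i := (0 : Fin 3)) (k := (0 : Fin 1)) (m := 1) (hd 0)
    (fun _ => rfl) v
  have e1 := leftMC_modelDeriv_face_mul (I := I) (i := (1 : Fin 3)) (k := (0 : Fin 1)) (m := 0)
    (n := 1) (fun _ => rfl) (1 : Nerve G 2) v
  have w1 : (v : Fin 2 → E) 1 = 0 := by
    rw [← e0]
    exact congrFun h0 0
  have w0 : (v : Fin 2 → E) 0 = 0 := by
    rw [h1, Pi.one_apply, Pi.one_apply, inv_one, adE_one, leftMC_one] at e1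
    have e2 : (0 : E) = (v : Fin 2 → E) 0 + (v : Fin 2 → E) 1 := by simpa using e1
    rw [w1, add_zero] at e2
    exact e2.symm
  have : (v : Fin 2 → E) = 0 := by
    funext i
    fin_cases i
    · exact w0
    · exact w1
  exact this

theorem boundaries_one : boundaries I G 1 = ⊥ := by
  rw [boundaries, tangentCx_two, Submodule.map_bot]

theorem cycles_two : cycles I G 2 = ⊥ := by
  rw [cycles, tangentCx_two, bot_inf_eq]

variable [CompleteSpace E]

/-- On `H_1 = 𝔤` the pairing of the tangent complex is `2⟨·,·⟩`. -/
theorem brylinskiWeinstein_degenT {B : LinearMap.BilinForm ℝ (GroupLieAlgebra I G)}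
    (hB : IsQuadratic B) (v w : Fin 1 → E) :
    brylinskiWeinstein B 1 ![degenT 1 v, degenT 0 w] -
      brylinskiWeinstein B 1 ![degenT 0 v, degenT 1 w] = 2 * formE B (v 0) (w 0) := by
  refine (congrArg₂ (· - ·) (brylinskiWeinstein_one_apply B _ _)
    (brylinskiWeinstein_one_apply B _ _)).trans ?_
  simp only [degenT_zero_of_one, degenT_one_of_one]
  simp [formE_symm hB (w 0)]
  ring

/-- The tangent complex has homology `𝔤` in degree `1` only, and there the pairing is
`2⟨·,·⟩`. -/
theorem omegaForm_nondegenerate {B : LinearMap.BilinForm ℝ (GroupLieAlgebra I G)}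
    (hB : IsQuadratic B) : (omegaForm B).Nondegenerate where
  zero := by
    rw [boundaries_zero, cycles_two]
    refine ⟨fun _ _ _ => trivial, fun w hw _ => ?_⟩
    rw [(Submodule.mem_bot ℝ).1 hw]
    exact Submodule.zero_mem _
  one := by
    rw [boundaries_one]
    have hE : ∀ a : E, (∀ b : E, formE B a b = 0) → a = 0 := hB.nondegenerate
    refine ⟨fun v _ hv => ?_, fun w _ hw => ?_⟩
    · have h : ∀ v : Fin 1 → E, (∀ w : Fin 1 → E, 2 * formE B (v 0) (w 0) = 0) → v = 0 := by
        intro v hv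
        funext i
        rw [Subsingleton.elim i 0]
        exact hE _ fun b => by simpa using hv fun _ => b
      exact h v fun w => (brylinskiWeinstein_degenT hB v w).symm.trans
        (hv w (mem_cycles_one I G w))
    · have h : ∀ w : Fin 1 → E, (∀ v : Fin 1 → E, 2 * formE B (v 0) (w 0) = 0) → w = 0 := by
        intro w hw
        funext i
        rw [Subsingleton.elim i 0]
        exact hE _ fun b => by simpa [formE_symm hB b] using hw fun _ => b
      exact h w fun v => (brylinskiWeinstein_degenT hB v w).symm.trans
        (hw v (mem_cycles_one I G v))
  two := by
    rw [boundaries_zero, cycles_two]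
    refine ⟨fun v hv _ => ?_, fun _ _ _ => trivial⟩
    rw [(Submodule.mem_bot ℝ).1 hv]
    exact Submodule.zero_mem _

end TangentComplex

/-! ### The pairing as a symplectic form of degree 2 -/

section Pairing

variable {𝔤 : Type*} [LieRing 𝔤] [LieAlgebra ℝ 𝔤] {B : LinearMap.BilinForm ℝ 𝔤}

theorem IsQuadratic.apply_of_ne (hB : IsQuadratic B) (b : Fin 2 → 𝔤) {j k : Fin 2} (h : j ≠ k) :
    B (b j) (b k) = B (b 0) (b 1) := by
  fin_cases j <;> fin_cases k
  · exact absurd rfl h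
  · rfl
  · exact hB.symm _ _
  · exact absurd rfl h

theorem pairing_mem_weil (hB : IsQuadratic B) : pairing B ∈ Weil 𝔤 2 2 := by
  refine ⟨fun b => ⟨AlternatingMap.constOfIsEmpty ℝ 𝔤 (Fin 0) (B (b 0) (b 1)), fun a => rfl⟩,
    fun a => ⟨MultilinearMap.mk' (fun b => B (b 0) (b 1)) ?_ ?_, fun b => rfl⟩, fun a b τ => ?_,
    fun h => absurd h (lt_irrefl 2)⟩
  · intro b i x y
    fin_cases i <;> simp
  · intro b i c x
    fin_cases i <;> simp
  · exact hB.apply_of_ne b fun h => absurd (τ.injective h) (by decide)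

theorem isDegreeTwoSymplecticQ_pairing (hB : IsQuadratic B) :
    IsDegreeTwoSymplecticQ (pairing B) where
  mem := pairing_mem_weil hB
  closed := rfl
  invariant := by
    funext a b
    have h : -B ⁅a 0, b 0⁆ (b 1) + -B (b 0) ⁅a 0, b 1⁆ = 0 := by
      rw [← neg_add, hB.invariant, neg_zero]
    have h' : weilDh (pairing B) a b =
        (∑ i : Fin 1, (-1 : ℝ) ^ (i : ℕ) *
          ∑ l : Fin 2, -B (Function.update b l ⁅a i, b l⁆ 0) (Function.update b l ⁅a i, b l⁆ 1)) +
        ∑ j : Fin 1, (0 : ℝ) := rfl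
    rw [h']
    simpa [add_comm] using h
  nondegenerate := hB.nondegenerate

end Pairing

/-! ### The Van Est map on `Ω` -/

section VanEstOmega

variable {E : Type*} [NormedAddCommGroup E] [NormedSpace ℝ E]
  {H : Type*} [TopologicalSpace H] {I : ModelWithCorners ℝ E H}
  {G : Type*} [TopologicalSpace G] [ChartedSpace H G] [Group G]

/-- There are no arrangements of `q` operators `J` in a word of length `p < q`. -/
theorem vanEst_eq_zero_of_lt [FiniteDimensional ℝ E] {p q : ℕ} (h : p < q) (η : NForm I G p q) :
    vanEst η = 0 := by
  have : IsEmpty (Fin p ≃ Fin (p - q) ⊕ Fin q) := ⟨fun σ => by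
    have := Fintype.card_congr σ
    simp only [Fintype.card_fin, Fintype.card_sum] at this
    omega⟩
  funext a b
  simp [vanEst]

theorem applyWord_of_inr [FiniteDimensional ℝ E] {p q : ℕ}
    {w : Fin (p + 1) → GroupLieAlgebra I G ⊕ GroupLieAlgebra I G} {b : GroupLieAlgebra I G}
    (h : w 0 = .inr b) (η : NForm I G (p + 1) (q + 1)) :
    applyWord (p + 1) (q + 1) w η = applyWord p q (Fin.tail w) (opJ b η) := by
  rw [applyWord, h]

variable [LieGroup I ∞ G]

theorem mulInvariantVectorField_one (a : GroupLieAlgebra I G) :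
    (mulInvariantVectorField a (1 : G) : E) = a := by
  have h := leftMC_mulInvariantVectorField (1 : G) a
  rw [leftMC_one] at h
  exact h

theorem hatField_degen_zero {p : ℕ} (a : GroupLieAlgebra I G) (g : Nerve G p) :
    (hatField a (degen 0 g) : Fin (p + 1) → E) = Fin.cons (a : E) 0 := by
  funext i
  refine Fin.cases ?_ (fun i => ?_) i
  · exact mulInvariantVectorField_one a
  · rfl

/-- `J_b` and then `J_c` evaluate `Ω` at the unit on `(b, 0)` and `(0, c)`. -/
theorem opJ_opJ_brylinskiWeinstein (B : LinearMap.BilinForm ℝ (GroupLieAlgebra I G))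
    (b c : GroupLieAlgebra I G) :
    opJ c (opJ b (brylinskiWeinstein B)) ![] ![] = B b c := by
  have h : opJ c (opJ b (brylinskiWeinstein B)) ![] ![] =
      brylinskiWeinstein B (degen 0 (degen 0 ![] : Nerve G 1))
        ![hatField b (degen 0 (degen 0 ![] : Nerve G 1)),
          modelDeriv (nerveModel I 1) (nerveModel I 2) (degen 0) (degen 0 ![] : Nerve G 1)
            (hatField c (degen 0 ![] : Nerve G 1))] := by
    refine congrArg (brylinskiWeinstein B (degen 0 (degen 0 ![] : Nerve G 1))) ?_
    funext i
    fin_cases i <;> rfl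
  have e : degen 0 (degen 0 ![] : Nerve G 1) = (1 : Nerve G 2) := by
    funext i
    fin_cases i <;> rfl
  rw [h]
  have hu : (hatField b (degen 0 (degen 0 ![] : Nerve G 1)) : Fin 2 → E) = ![b, 0] := by
    refine (hatField_degen_zero b (degen 0 ![] : Nerve G 1)).trans ?_
    funext i
    fin_cases i <;> rfl
  have hw : modelDeriv (nerveModel I 1) (nerveModel I 2) (degen 0) (degen 0 ![] : Nerve G 1)
      (hatField c (degen 0 ![] : Nerve G 1)) = ![0, c] := by
    refine (modelDeriv_degen_zero_of_one _ _).trans ?_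
    exact congrArg (fun u : Fin 1 → E => ![0, u 0]) (hatField_degen_zero c (![] : Nerve G 0))
  refine (congrArg₂ (fun u w : Fin 2 → E => brylinskiWeinstein B
    (degen 0 (degen 0 ![] : Nerve G 1)) ![u, w]) hu hw).trans ?_
  rw [e]
  refine (brylinskiWeinstein_one_apply B _ _).trans ?_
  have h0 : formE B 0 0 = 0 := LinearMap.map_zero _
  exact (congrArg (formE B (b : E) c - ·) h0).trans (sub_zero _)

variable [FiniteDimensional ℝ E] [CompleteSpace E]

/-- The two arrangements of `J_{b₁}, J_{b₂}` contribute `⟨b₁, b₂⟩` each, the factor `1/2!` makes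
this `⟨b₁, b₂⟩`, and the sign is `(-1)^3`. -/
theorem vanEst_brylinskiWeinstein {B : LinearMap.BilinForm ℝ (GroupLieAlgebra I G)}
    (hB : IsQuadratic B) :
    vanEst (brylinskiWeinstein B) = -pairing B := by
  funext a b
  have hσ : ∀ σ : Fin 2 ≃ Fin (2 - 2) ⊕ Fin 2,
      koszulSign σ * applyWord 2 2 (fun i => Sum.map a b (σ i)) (brylinskiWeinstein B) =
        B (b 0) (b 1) := by
    intro σ
    have hinr : ∀ i, ∃ j, σ i = .inr j := fun i => by
      rcases h : σ i with j | j
      · exact (IsEmpty.false (α := Fin 0) j).elim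
      · exact ⟨j, rfl⟩
    obtain ⟨j, hj⟩ := hinr 0
    obtain ⟨k, hk⟩ := hinr 1
    have hne : j ≠ k := by
      rintro rfl
      exact absurd (σ.injective (hj.trans hk.symm)) (by decide)
    have hs : koszulSign σ = 1 := by
      simp [koszulSign, Fin.prod_univ_two, hj, hk]
    have h0 : Sum.map a b (σ 0) = .inr (b j) := by rw [hj]; rfl
    have h1 : Sum.map a b (σ 1) = .inr (b k) := by rw [hk]; rfl
    rw [hs, one_mul, applyWord_of_inr h0, applyWord_of_inr h1]
    exact (opJ_opJ_brylinskiWeinstein B (b j) (b k)).trans (hB.apply_of_ne b hne)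
  have hc : Fintype.card (Fin 2 ≃ Fin (2 - 2) ⊕ Fin 2) = 2 :=
    Fintype.card_equiv (Equiv.emptySum (Fin 0) (Fin 2)).symm
  rw [vanEst, Finset.sum_congr rfl fun σ _ => hσ σ, Finset.sum_const, Finset.card_univ, hc]
  change _ = -B (b 0) (b 1)
  norm_num [Nat.factorial]
  ring

end VanEstOmega

/-! ### Integration of the quadratic Lie algebra -/

section Integration

variable {E : Type*} [NormedAddCommGroup E] [NormedSpace ℝ E] [FiniteDimensional ℝ E]
  [CompleteSpace E] {H : Type*} [TopologicalSpace H] {I : ModelWithCorners ℝ E H}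
  {G : Type*} [TopologicalSpace G] [ChartedSpace H G] [Group G] [LieGroup I ∞ G]

theorem vanEst_omegaForm {B : LinearMap.BilinForm ℝ (GroupLieAlgebra I G)} (hB : IsQuadratic B) :
    (omegaForm B).vanEst = (-pairing B, 0, 0) :=
  Prod.ext (vanEst_brylinskiWeinstein hB) (Prod.ext (vanEst_eq_zero_of_lt (by decide) _)
    (vanEst_eq_zero_of_lt (by decide) _))

theorem integrates_omegaForm [I.Boundaryless] {B : LinearMap.BilinForm ℝ (GroupLieAlgebra I G)}
    (hB : IsQuadratic B) (hAd : AdInvariant B) : Integrates (omegaForm B) (pairing B) where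
  source := ⟨omegaForm_normalized hB, omegaForm_closed hB hAd, omegaForm_nondegenerate hB⟩
  target := isDegreeTwoSymplecticQ_pairing hB
  vanEst_eq := vanEst_omegaForm hB

end Integration

end VanEst

end

theorem mainTheorem12 {E : Type*} [NormedAddCommGroup E] [NormedSpace ℝ E] [FiniteDimensional ℝ E]
    [CompleteSpace E] {H : Type*} [TopologicalSpace H] (I : ModelWithCorners ℝ E H)
    [I.Boundaryless] (G : Type*) [TopologicalSpace G] [ChartedSpace H G] [Group G] [LieGroup I ∞ G]
    (B : LinearMap.BilinForm ℝ (GroupLieAlgebra I G)) (hB : VanEst.IsQuadratic B) :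
    VanEst.pairing B ∈ VanEst.Weil (GroupLieAlgebra I G) 2 2 ∧
    (VanEst.omegaForm B).Normalized ∧
    (VanEst.omegaForm B).vanEst = (-VanEst.pairing B, 0, 0) ∧
    VanEst.IsDegreeTwoSymplecticQ (VanEst.pairing B) ∧
    (PreconnectedSpace G ∨ VanEst.AdInvariant B →
      VanEst.Integrates (VanEst.omegaForm B) (VanEst.pairing B)) := by
  refine ⟨VanEst.pairing_mem_weil hB, VanEst.omegaForm_normalized hB, VanEst.vanEst_omegaForm hB,
    VanEst.isDegreeTwoSymplecticQ_pairing hB, fun h => VanEst.integrates_omegaForm hB ?_⟩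
  rcases h with _ | h
  · exact VanEst.adInvariant_of_preconnectedSpace hB
  · exact h
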